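/- Let $k$ be a field. A *Nakayama algebra* over $k$ is an algebra $A\cong kQ/I$, where $Q$ is, for some $N\ge 1$, either the linearly oriented line $1\to 2\to\cdots\to N$ or the linearly oriented cycle $1\to 2\to\cdots\to N\to 1$, and $I$ is an admissible ideal of the path algebra $kQ$, that is, $J^m\subseteq I\subseteq J^2$ for some $m\ge 2$, where $J$ is the ideal generated by the arrows. For $m\ge 1$, the algebra $A$ is called *$m$-Gorenstein* if in a minimal injective resolution $$0\to A_A\to I^0\to I^1\to I^2\to\cdots$$ of the right regular module $A_A$ one has $\operatorname{pdim} I^i\le i$ for every $0\le i<m$. **Theorem.** (1) Let $A$ be a Nakayama algebra over $k$. If $A$ is $2n$-Gorenstein for some integer $n\ge 1$, then $A$ is also $(2n+1)$-Gorenstein. (2) Parity matters: for every integer $n\ge 1$ there is a Nakayama algebra over $k$ which is $(2n+1)$-Gorenstein but not $(2n+2)$-Gorenstein. -/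

import Mathlib

universe u v w

noncomputable section

/-! ### Path algebras -/

/-- A path of a quiver together with its start vertex `p.1` and its end vertex `p.2.1`. -/
abbrev QuiverPath (V : Type v) [Quiver.{w} V] := Σ a b : V, Quiver.Path a b

/-- The path algebra `kQ` of a finite quiver with vertex set `V`: the `k`-vector space whose basis
is the set of all paths (including the paths of length zero), with multiplication defined below. -/
def PathAlgebra (k : Type u) [Field k] (V : Type v) [Quiver.{w} V] := QuiverPath V →₀ k

namespace PathAlgebra

variable {k : Type u} [Field k] {V : Type v} [Quiver.{w} V]

instance : AddCommGroup (PathAlgebra k V) := inferInstanceAs (AddCommGroup (QuiverPath V →₀ k))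

instance : Module k (PathAlgebra k V) := inferInstanceAs (Module k (QuiverPath V →₀ k))

variable (k V) in
/-- The basis of `kQ` that consists of the paths. -/
def pathBasis : Module.Basis (QuiverPath V) k (PathAlgebra k V) :=
  Module.Basis.ofRepr (LinearEquiv.refl k (QuiverPath V →₀ k))

/-- The basis element of `kQ` that belongs to a path. -/
def ofPath (p : QuiverPath V) : PathAlgebra k V := pathBasis k V p

open Classical in
/-- The product of two basis elements: paths are composed from left to right, and the product
is zero if the end of `p` is not the start of `q`. -/
def pathMul (p q : QuiverPath V) : PathAlgebra k V :=
  if h : p.2.1 = q.1 then ofPath ⟨p.1, q.2.1, p.2.2.comp (q.2.2.cast h.symm rfl)⟩ else 0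

/-- The multiplication of `kQ`: the bilinear extension of `pathMul`. -/
def mulHom : PathAlgebra k V →ₗ[k] PathAlgebra k V →ₗ[k] PathAlgebra k V :=
  (pathBasis k V).constr k fun p => (pathBasis k V).constr k fun q => pathMul p q

theorem mulHom_ofPath (p q : QuiverPath V) :
    mulHom (ofPath p : PathAlgebra k V) (ofPath q) = pathMul p q := by
  simp [mulHom, ofPath]

theorem pathMul_comp {a b c : V} (p : Quiver.Path a b) (q : Quiver.Path b c) :
    (pathMul ⟨a, b, p⟩ ⟨b, c, q⟩ : PathAlgebra k V) = ofPath ⟨a, c, p.comp q⟩ := by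
  simp [pathMul]

theorem pathMul_of_ne {p q : QuiverPath V} (h : p.2.1 ≠ q.1) :
    (pathMul p q : PathAlgebra k V) = 0 := by
  simp [pathMul, h]

@[elab_as_elim]
theorem induction_on {P : PathAlgebra k V → Prop} (x : PathAlgebra k V)
    (path : ∀ p, P (ofPath p)) (add : ∀ x y, P x → P y → P (x + y)) (zero : P 0)
    (smul : ∀ (r : k) x, P x → P (r • x)) : P x := by
  refine Submodule.span_induction (p := fun x _ => P x) ?_ zero (fun x y _ _ => add x y)
    (fun r x _ => smul r x) ((pathBasis k V).mem_span x)
  rintro _ ⟨p, rfl⟩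
  exact path p

theorem mulHom_assoc (x y z : PathAlgebra k V) :
    mulHom (mulHom x y) z = mulHom x (mulHom y z) := by
  induction x using induction_on with
  | add a b ha hb => simp only [map_add, LinearMap.add_apply, ha, hb]
  | zero => simp only [map_zero, LinearMap.zero_apply]
  | smul r a ha => simp only [map_smul, LinearMap.smul_apply, ha]
  | path p =>
  induction y using induction_on with
  | add a b ha hb => simp only [map_add, LinearMap.add_apply, ha, hb]
  | zero => simp only [map_zero, LinearMap.zero_apply]
  | smul r a ha => simp only [map_smul, LinearMap.smul_apply, ha]
  | path q =>
  induction z using induction_on with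
  | add a b ha hb => simp only [map_add, ha, hb]
  | zero => simp only [map_zero]
  | smul r a ha => simp only [map_smul, ha]
  | path s =>
  obtain ⟨a, b, p⟩ := p
  obtain ⟨c, d, q⟩ := q
  obtain ⟨e, f, s⟩ := s
  rw [mulHom_ofPath, mulHom_ofPath]
  by_cases h₁ : b = c
  · subst h₁
    rw [pathMul_comp, mulHom_ofPath]
    by_cases h₂ : d = e
    · subst h₂
      rw [pathMul_comp, pathMul_comp, mulHom_ofPath, pathMul_comp, Quiver.Path.comp_assoc]
    · rw [pathMul_of_ne (by exact h₂), pathMul_of_ne (by exact h₂), map_zero]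
  · rw [pathMul_of_ne (by exact h₁), map_zero, LinearMap.zero_apply]
    by_cases h₂ : d = e
    · subst h₂
      rw [pathMul_comp, mulHom_ofPath, pathMul_of_ne (by exact h₁)]
    · rw [pathMul_of_ne (by exact h₂), map_zero]

variable [Fintype V]

/-- The unit of `kQ`: the sum of all paths of length zero. -/
def unit : PathAlgebra k V := ∑ a : V, ofPath ⟨a, a, Quiver.Path.nil⟩

theorem unit_mulHom (x : PathAlgebra k V) : mulHom unit x = x := by
  induction x using induction_on with
  | add a b ha hb => rw [map_add, ha, hb]
  | zero => rw [map_zero]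
  | smul r a ha => rw [map_smul, ha]
  | path p =>
  obtain ⟨a, b, p⟩ := p
  rw [unit, map_sum, LinearMap.sum_apply, Finset.sum_eq_single a]
  · rw [mulHom_ofPath, pathMul_comp, Quiver.Path.nil_comp]
  · intro c _ hc
    rw [mulHom_ofPath, pathMul_of_ne (by exact hc)]
  · intro h
    exact absurd (Finset.mem_univ a) h

theorem mulHom_unit (x : PathAlgebra k V) : mulHom x unit = x := by
  induction x using induction_on with
  | add a b ha hb => rw [map_add, LinearMap.add_apply, ha, hb]
  | zero => rw [map_zero, LinearMap.zero_apply]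
  | smul r a ha => rw [map_smul, LinearMap.smul_apply, ha]
  | path p =>
  obtain ⟨a, b, p⟩ := p
  rw [unit, map_sum, Finset.sum_eq_single b]
  · rw [mulHom_ofPath, pathMul_comp, Quiver.Path.comp_nil]
  · intro c _ hc
    rw [mulHom_ofPath, pathMul_of_ne (by exact hc.symm)]
  · intro h
    exact absurd (Finset.mem_univ b) h

instance : Ring (PathAlgebra k V) where
  __ := (inferInstance : AddCommGroup (PathAlgebra k V))
  mul x y := mulHom x y
  one := unit
  left_distrib x y z := map_add (mulHom x) y z
  right_distrib x y z := LinearMap.map_add₂ mulHom x y z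
  zero_mul x := LinearMap.map_zero₂ mulHom x
  mul_zero x := map_zero (mulHom x)
  mul_assoc := mulHom_assoc
  one_mul := unit_mulHom
  mul_one := mulHom_unit

instance : Algebra k (PathAlgebra k V) :=
  Algebra.ofModule (fun r x y => LinearMap.map_smul₂ mulHom r x y)
    (fun r x y => map_smul (mulHom x) r y)

variable (k V) in
/-- The `m`-th power `J ^ m` of the ideal `J` of `kQ` generated by the arrows, that is,
the two-sided ideal generated by the paths of length `m`. -/
def arrowIdealPow (m : ℕ) : TwoSidedIdeal (PathAlgebra k V) :=
  TwoSidedIdeal.span {x | ∃ p : QuiverPath V, p.2.2.length = m ∧ x = ofPath p}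

/-- A two-sided ideal `I` of `kQ` is admissible if `J ^ m ⊆ I ⊆ J ^ 2` for some `m ≥ 2`. -/
def IsAdmissible (I : TwoSidedIdeal (PathAlgebra k V)) : Prop :=
  I ≤ arrowIdealPow k V 2 ∧ ∃ m : ℕ, 2 ≤ m ∧ arrowIdealPow k V m ≤ I

end PathAlgebra

/-- `A` is isomorphic to `kQ/I` for an admissible ideal `I` of the path algebra of the finite
quiver with vertex set `V`. -/
def IsQuiverAlgebra (k : Type u) [Field k] (V : Type v) [Quiver.{w} V] [Fintype V]
    (A : Type*) [Ring A] [Algebra k A] : Prop :=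
  ∃ I : TwoSidedIdeal (PathAlgebra k V),
    PathAlgebra.IsAdmissible I ∧ Nonempty (A ≃ₐ[k] I.ringCon.Quotient)

/-! ### Nakayama algebras -/

/-- The vertices `0, 1, …, N - 1` of the linear quiver `0 → 1 → ⋯ → N - 1`. -/
structure LinearQuiver (N : ℕ) where
  /-- the number of the vertex -/
  vertex : Fin N

instance (N : ℕ) : Fintype (LinearQuiver N) :=
  Fintype.ofEquiv (Fin N) ⟨fun i => ⟨i⟩, fun i => i.vertex, fun _ => rfl, fun _ => rfl⟩

/-- There is exactly one arrow `i → i + 1` for `0 ≤ i < N - 1`, and there are no other arrows. -/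
instance (N : ℕ) : Quiver.{0} (LinearQuiver N) where
  Hom i j := PLift ((j.vertex : ℕ) = (i.vertex : ℕ) + 1)

/-- The vertices `0, 1, …, N - 1` of the cyclic quiver `0 → 1 → ⋯ → N - 1 → 0`. -/
structure CyclicQuiver (N : ℕ) where
  /-- the number of the vertex -/
  vertex : Fin N

instance (N : ℕ) : Fintype (CyclicQuiver N) :=
  Fintype.ofEquiv (Fin N) ⟨fun i => ⟨i⟩, fun i => i.vertex, fun _ => rfl, fun _ => rfl⟩

/-- There is exactly one arrow `i → i + 1` for each `i` modulo `N`, and there are no other arrows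
(for `N = 1` this is one vertex with one loop). -/
instance (N : ℕ) : Quiver.{0} (CyclicQuiver N) where
  Hom i j := PLift ((j.vertex : ℕ) = ((i.vertex : ℕ) + 1) % N)

/-- `A` is a Nakayama algebra over `k`: `A ≅ kQ/I` where `I` is an admissible ideal and `Q` is a
linearly oriented line or a linearly oriented cycle with `N ≥ 1` vertices. -/
def IsNakayamaAlgebra (k : Type u) [Field k] (A : Type*) [Ring A] [Algebra k A] : Prop :=
  ∃ N : ℕ, 1 ≤ N ∧
    (IsQuiverAlgebra k (LinearQuiver N) A ∨ IsQuiverAlgebra k (CyclicQuiver N) A)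

/-! ### Minimal injective resolutions and the `n`-Gorenstein property -/

open CategoryTheory

/-- A submodule is essential if it meets every nonzero submodule nontrivially. -/
def IsEssentialSubmodule {R : Type u} [Ring R] {M : Type v} [AddCommGroup M] [Module R M]
    (K : Submodule R M) : Prop :=
  ∀ L : Submodule R M, K ⊓ L = ⊥ → L = ⊥

/-- An injective resolution `0 → M → I⁰ → I¹ → ⋯` is minimal if the kernel of `Iⁱ → Iⁱ⁺¹`
(that is, the image of `M` for `i = 0` and the image of `Iⁱ⁻¹` for `i > 0`) is an essential
submodule of `Iⁱ` for all `i`, so that `Iⁱ` is an injective envelope of this kernel. -/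
def IsMinimalInjectiveResolution {R : Type u} [Ring R] {M : ModuleCat.{v} R}
    (E : InjectiveResolution M) : Prop :=
  ∀ i : ℕ, IsEssentialSubmodule (LinearMap.ker (E.cocomplex.d i (i + 1)).hom)

/-- `A` is `n`-Gorenstein if a minimal injective resolution `0 → A → I⁰ → I¹ → ⋯` of the regular
right module `A` satisfies `pdim Iⁱ ≤ i` for `0 ≤ i < n`. Right `A`-modules are modules over
`Aᵐᵒᵖ`. -/
def IsNGorenstein (n : ℕ) (A : Type u) [Ring A] : Prop :=
  ∃ E : InjectiveResolution (ModuleCat.of Aᵐᵒᵖ A), IsMinimalInjectiveResolution E ∧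
    ∀ i < n, HasProjectiveDimensionLE (E.cocomplex.X i) i

end

/-! ### Combinatorics of interval modules

Interval modules over a Nakayama algebra are described by pairs of integers; `p` is the monotone map
that sends `a` to the end of the projective module with top `a`, and `q` is its left adjoint. -/

/-! Vertices are lifted to integers, with residue classes modulo `N` as labels. For `a ≤ b ≤ p a`
there is a uniserial right module `[a, b)` with top `a`. The inequality `c i ≤ c (i + 1) + 1` makes
`p` monotone, so it has a left adjoint `q`. The module `[a, p a)` is projective and `[q b, b)` is
injective. The sequences `[b, p a) → [a, p a) → [a, b)` and `[x, y) → [q y, y) → [q y, x)` turn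
syzygies and cosyzygies into arithmetic with `p` and `q`: two syzygies apply `p` to both ends, two
cosyzygies apply `q`. The regular module is the sum of the `[x, p x)`, so the Gorenstein condition
becomes `TermPdLE` for each `x` (`NakayamaDatum.isNGorenstein_iff`).

Part (1) is `TermPdLE.even`. As long as no cosyzygy vanishes, the term of degree `2m + 1` is
`[q^(m+1) x, q^m x)`. Its bound says that `p^(m+1) q^(m+1) x` equals either `p^m q^m x` or `p^(m+1)
q^m x`. The second would make a cosyzygy vanish, so inductively `p^m q^m x = x` for all `m ≤ n`.
With the unit of the adjunction this gives `p^n q^n (p x) = p x = p^(n+1) q^(n+1) (p x)`, so the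
`2n`-th syzygy of the term of degree `2n` is projective. Only the odd terms enter as hypotheses.

Part (2) uses the cycle with `3n + 2` vertices, where the projective at `0` has length `4` and the
others have length `3`. Only the projective at `1` fails to be injective. Its odd terms `[-3m-2,
1-3m)` have length `3`, hence are projective until `m = n`, where the start reaches the exceptional
residue class `0` and the projective dimension exceeds `2n + 1`. -/

namespace Nakayama

/-- The combinatorial criterion for the interval module `[a, b)` to have projective dimension
at most `n`. -/
def PdLE (p : ℤ → ℤ) : ℕ → ℤ → ℤ → Prop
  | 0, a, b => a = b ∨ b = p a
  | n + 1, a, b => PdLE p n b (p a)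

/-- The `j`-th cosyzygy of the interval `[x, y)`. -/
def cosyzygy (q : ℤ → ℤ) (x y : ℤ) : ℕ → ℤ × ℤ
  | 0 => (x, y)
  | j + 1 => if (cosyzygy q x y j).1 = (cosyzygy q x y j).2 then cosyzygy q x y j
      else (q (cosyzygy q x y j).2, (cosyzygy q x y j).1)

/-- The start of the injective envelope of an interval. -/
def hullStart (q : ℤ → ℤ) (st : ℤ × ℤ) : ℤ := if st.1 = st.2 then st.1 else q st.2

/-- The criterion for the `j`-th term of the minimal injective resolution of the projective module
with top `x` to have projective dimension at most `j`. -/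
def TermPdLE (p q : ℤ → ℤ) (x : ℤ) (j : ℕ) : Prop :=
  PdLE p j (hullStart q (cosyzygy q x (p x) j)) (cosyzygy q x (p x) j).2

variable {p q : ℤ → ℤ}

/-- The second syzygy of `[a, b)` is `[p a, p b)`; the two alternatives say that the `2m`-th one is
zero or projective. -/
theorem pdLE_even (m : ℕ) (a b : ℤ) :
    PdLE p (2 * m) a b ↔ p^[m] a = p^[m] b ∨ p^[m] b = p^[m + 1] a := by
  induction m generalizing a b with
  | zero => simp [PdLE]
  | succ m ih => exact ih (p a) (p b)

theorem pdLE_odd (m : ℕ) (a b : ℤ) :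
    PdLE p (2 * m + 1) a b ↔ p^[m] b = p^[m + 1] a ∨ p^[m + 1] a = p^[m + 1] b := by
  rw [PdLE, pdLE_even]
  simp

/-- The recursion covers the zero interval `[a, a)` by `[a, p a)`, so it exchanges the zero and the
projective case; the two must be proved together. -/
theorem pdLE_self_and_projective (n : ℕ) (a : ℤ) : PdLE p n a a ∧ PdLE p n a (p a) := by
  induction n generalizing a with
  | zero => exact ⟨Or.inl rfl, Or.inr rfl⟩
  | succ n ih => exact ⟨(ih a).2, (ih (p a)).1⟩

theorem pdLE_self (n : ℕ) (a : ℤ) : PdLE p n a a := (pdLE_self_and_projective n a).1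

theorem cosyzygy_le (gc : GaloisConnection q p) {x y : ℤ} (h : x ≤ y) (h' : y ≤ p x) (j : ℕ) :
    (cosyzygy q x y j).1 ≤ (cosyzygy q x y j).2 ∧
      (cosyzygy q x y j).2 ≤ p (cosyzygy q x y j).1 := by
  induction j with
  | zero => exact ⟨h, h'⟩
  | succ j ih =>
    rw [cosyzygy]
    split_ifs
    · exact ih
    · exact ⟨gc.l_le ih.2, ih.1.trans (gc.le_u_l _)⟩

theorem cosyzygy_degenerate {x y : ℤ} {j : ℕ}
    (h : (cosyzygy q x y j).1 = (cosyzygy q x y j).2) {k : ℕ} (hk : j ≤ k) :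
    (cosyzygy q x y k).1 = (cosyzygy q x y k).2 := by
  induction k, hk using Nat.le_induction with
  | base => exact h
  | succ k _ ih => rw [cosyzygy, if_pos ih]; exact ih

/-- A cosyzygy step moves the old start to the end and `q` of the old end to the start, so two steps
apply `q` to both. Nondegeneracy is needed because `cosyzygy` is frozen once the interval is empty.
-/
theorem cosyzygy_even {x y : ℤ} {m : ℕ}
    (h : ∀ j < 2 * m, (cosyzygy q x y j).1 ≠ (cosyzygy q x y j).2) :
    cosyzygy q x y (2 * m) = (q^[m] x, q^[m] y) := by
  induction m with
  | zero => rfl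
  | succ m ih =>
    have h0 := ih fun j hj => h j (by omega)
    have h1 := h (2 * m) (by omega)
    have h2 := h (2 * m + 1) (by omega)
    rw [show 2 * (m + 1) = 2 * m + 1 + 1 by ring, cosyzygy, if_neg h2, cosyzygy, if_neg h1, h0]
    simp only [Function.iterate_succ_apply']

theorem cosyzygy_odd {x y : ℤ} {m : ℕ}
    (h : ∀ j < 2 * m + 1, (cosyzygy q x y j).1 ≠ (cosyzygy q x y j).2) :
    cosyzygy q x y (2 * m + 1) = (q^[m + 1] y, q^[m] x) := by
  rw [cosyzygy, if_neg (h _ (by omega)), cosyzygy_even fun j hj => h j (by omega),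
    Function.iterate_succ_apply']

theorem galoisConnection_iterate (gc : GaloisConnection q p) (m : ℕ) :
    GaloisConnection q^[m] p^[m] := by
  induction m with
  | zero => exact fun _ _ => Iff.rfl
  | succ m ih =>
    intro a b
    rw [Function.iterate_succ_apply', Function.iterate_succ_apply, gc, ih]

theorem TermPdLE.of_degenerate {x : ℤ} {j : ℕ}
    (h : (cosyzygy q x (p x) j).1 = (cosyzygy q x (p x) j).2) : TermPdLE p q x j := by
  rw [TermPdLE, hullStart, if_pos h, h]
  exact pdLE_self _ _

/-- If the odd terms below `2 * n` satisfy the Gorenstein bound, so does the term `2 * n`. -/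
theorem TermPdLE.even (gc : GaloisConnection q p) {x : ℤ} (hx : x ≤ p x) {n : ℕ}
    (h : ∀ m < n, TermPdLE p q x (2 * m + 1)) : TermPdLE p q x (2 * n) := by
  by_cases hd : (cosyzygy q x (p x) (2 * n)).1 = (cosyzygy q x (p x) (2 * n)).2
  · exact TermPdLE.of_degenerate hd
  have hne : ∀ j ≤ 2 * n, (cosyzygy q x (p x) j).1 ≠ (cosyzygy q x (p x) j).2 :=
    fun j hj h' => hd (cosyzygy_degenerate h' hj)
  have hev : ∀ m ≤ n, cosyzygy q x (p x) (2 * m) = (q^[m] x, q^[m] (p x)) :=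
    fun m hm => cosyzygy_even fun j hj => hne j (by omega)
  have hod : ∀ m < n, cosyzygy q x (p x) (2 * m + 1) = (q^[m + 1] (p x), q^[m] x) :=
    fun m hm => cosyzygy_odd fun j hj => hne j (by omega)
  have hlt : ∀ j ≤ 2 * n, (cosyzygy q x (p x) j).1 < (cosyzygy q x (p x) j).2 :=
    fun j hj => lt_of_le_of_ne (cosyzygy_le gc hx le_rfl j).1 (hne j hj)
  -- The heart of the argument: the odd bounds make the unit of the adjunction an equality at `x`
  -- for the iterates up to `n`.
  have hpq : ∀ m ≤ n, p^[m] (q^[m] x) = x := by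
    intro m
    induction m with
    | zero => intro _; rfl
    | succ m ih =>
      intro hm
      have h1 := h m (by omega)
      have hl1 := hlt (2 * m + 1) (by omega)
      have hl2 := hlt (2 * (m + 1)) (by omega)
      have hn1 := hne (2 * m + 1) (by omega)
      rw [hev (m + 1) hm] at hl2
      rw [TermPdLE, hullStart, if_neg hn1, pdLE_odd] at h1
      rw [hod m (by omega)] at h1 hl1
      simp only at h1 hl1 hl2
      rw [← Function.iterate_succ_apply' q] at h1
      rcases h1 with h1 | h1
      · rw [← h1, ih (by omega)]
      -- The chain `q^(m+1) x < q^(m+1) (p x) < q^m x` has equal outer values under `p^(m+1)`, so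
      -- the middle value agrees with them. Applying `q^(m+1)` then identifies the ends of the next
      -- cosyzygy, which is nonempty.
      · have gcm := galoisConnection_iterate gc (m + 1)
        have h2 : p^[m + 1] (q^[m + 1] x) = p^[m + 1] (q^[m + 1] (p x)) :=
          le_antisymm (gcm.monotone_u hl2.le) (h1 ▸ gcm.monotone_u hl1.le)
        have h3 := congrArg q^[m + 1] h2
        rw [gcm.l_u_l_eq_l, gcm.l_u_l_eq_l] at h3
        exact absurd h3 hl2.ne
  have gcn := galoisConnection_iterate gc n
  have gcn1 := galoisConnection_iterate gc (n + 1)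
  -- The unit gives one inequality. The other comes from the order of the ends of the preceding odd
  -- cosyzygy together with `hpq`.
  have e1 : p^[n] (q^[n] (p x)) = p x := by
    refine le_antisymm ?_ (gcn.le_u_l _)
    rcases n with _ | n
    · rfl
    have hl := hlt (2 * n + 1) (by omega)
    rw [hod n (by omega)] at hl
    calc p^[n + 1] (q^[n + 1] (p x)) ≤ p^[n + 1] (q^[n] x) := gcn.monotone_u hl.le
      _ = p x := by rw [Function.iterate_succ_apply', hpq n (by omega)]
  have e2 : p^[n + 1] (q^[n + 1] (p x)) = p x := by
    refine le_antisymm ?_ (gcn1.le_u_l _)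
    calc p^[n + 1] (q^[n + 1] (p x)) ≤ p^[n + 1] (q^[n] x) := by
          refine gcn1.monotone_u ?_
          rw [Function.iterate_succ_apply]
          exact gcn.monotone_l (gc.l_le le_rfl)
      _ = p x := by rw [Function.iterate_succ_apply', hpq n le_rfl]
  rw [TermPdLE, hullStart, if_neg hd, pdLE_even, hev n le_rfl]
  right
  simp only
  rw [← Function.iterate_succ_apply' q, e1, e2]

end Nakayama

/-! ### Algebras with a multiplicative basis of cyclic paths -/

/-- Path elements in a Nakayama algebra `A`: `w i l` is the path of length `l` that starts at the
vertex `i`, and `c i` is the length of the indecomposable projective right module with top `i`. -/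
structure NakayamaDatum (k : Type u) [Field k] (A : Type u) [Ring A] [Algebra k A] (N : ℕ)
    [NeZero N] where
  /-- the lengths of the indecomposable projective modules -/
  c : ZMod N → ℕ
  /-- the path elements -/
  w : ZMod N → ℕ → A
  mul_w : ∀ i l j m, w i l * w j m = if j = i + l then w i (l + m) else 0
  sum_w : ∑ i, w i 0 = 1
  w_eq_zero : ∀ i l, w i l = 0 ↔ c i ≤ l
  span_w : Submodule.span k (Set.range fun x : ZMod N × ℕ => w x.1 x.2) = ⊤

namespace NakayamaDatum

open MulOpposite

noncomputable section

variable {k : Type u} [Field k] {A : Type u} [Ring A] [Algebra k A] {N : ℕ} [NeZero N]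
  (D : NakayamaDatum k A N)

theorem c_le_c_add_one (i : ZMod N) : D.c i ≤ D.c (i + 1) + 1 := by
  have h : D.w i 1 * D.w (i + 1) (D.c (i + 1)) = 0 := by
    rw [(D.w_eq_zero _ _).2 le_rfl, mul_zero]
  rw [D.mul_w, if_pos (by simp), D.w_eq_zero] at h
  omega

/-- The end of the projective interval module that starts at `j`. -/
def p (j : ℤ) : ℤ := j + D.c j

theorem p_monotone : Monotone D.p := by
  refine monotone_int_of_le_succ fun j => ?_
  have := D.c_le_c_add_one j
  simp only [p]
  push_cast
  omega

theorem le_p (j : ℤ) : j ≤ D.p j := by simp [p]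

/-- The left adjoint of `p`: the start of the injective interval module with end `b`. -/
def q (b : ℤ) : ℤ := sInf {x | b ≤ D.p x}

/-- Since `p` differs from the identity by at most a constant, the set defining `q b` is bounded
below; it contains `b`. Hence its infimum is attained and is not a default value. -/
theorem gc : GaloisConnection D.q D.p := by
  obtain ⟨C, hC⟩ : ∃ C : ℕ, ∀ i, D.c i ≤ C :=
    ⟨_, fun i => Finset.le_sup (f := D.c) (Finset.mem_univ i)⟩
  have hb : ∀ b, BddBelow {x | b ≤ D.p x} := fun b => ⟨b - C, fun x hx => by
    have := hC x
    simp only [Set.mem_ofPred_eq, p] at hx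
    omega⟩
  intro b x
  constructor
  · intro h
    exact le_trans (Int.csInf_mem (s := {x | b ≤ D.p x}) ⟨b, D.le_p b⟩ (hb b)) (D.p_monotone h)
  · exact fun h => csInf_le (hb b) h

theorem linearIndependent_w : LinearIndependent k
    fun x : {x : ZMod N × ℕ // x.2 < D.c x.1} => D.w x.1.1 x.1.2 := by
  classical
  rw [linearIndependent_iff']
  intro s g hg
  by_contra! hne
  obtain ⟨x₀, hx₀⟩ := hne
  -- Take a shortest path `(i, l)` with nonzero coefficient. Multiplying by `w i 0` on the left
  -- removes the other starting vertices. The factor on the right extends this path to the longest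
  -- nonzero one, of length `c i - 1`, and kills all longer paths from `i`.
  obtain ⟨x, hx, hmin⟩ := Finset.exists_min_image (s.filter fun x => g x ≠ 0)
    (fun x => x.1.2) ⟨x₀, by simpa using hx₀⟩
  obtain ⟨⟨i, l⟩, hl⟩ := x
  simp only [Finset.mem_filter] at hx hmin
  simp only at hl
  have h := congrArg (fun a => D.w i 0 * a * D.w (i + l) (D.c i - 1 - l)) hg
  simp only [Finset.mul_sum, Finset.sum_mul, mul_zero, zero_mul] at h
  rw [Finset.sum_eq_single ⟨(i, l), hl⟩] at h
  · rw [mul_smul_comm, smul_mul_assoc, D.mul_w, if_pos (by simp), D.mul_w, if_pos (by simp),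
      smul_eq_zero_iff_right hx.2, D.w_eq_zero] at h
    simp only at h
    omega
  · rintro ⟨⟨j, m⟩, hm⟩ hjs hj
    simp only at hm ⊢
    by_cases hgz : g ⟨(j, m), hm⟩ = 0
    · rw [hgz]; simp
    have h1 := hmin ⟨(j, m), hm⟩ ⟨hjs, hgz⟩
    simp only at h1
    rw [mul_smul_comm, smul_mul_assoc, D.mul_w]
    split_ifs with h2
    · have h3 : j = i := by simpa using h2
      subst h3
      rw [D.mul_w]
      split_ifs with h4
      · have h5 : m ≠ l := by
          rintro rfl
          exact hj rfl
        rw [(D.w_eq_zero _ _).2 (by omega), smul_zero]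
      · simp
    · simp
  · intro h'
    exact absurd hx.1 h'

/-- The basis of `A` that consists of the nonzero paths. -/
def basis : Module.Basis {x : ZMod N × ℕ // x.2 < D.c x.1} k A :=
  Module.Basis.mk D.linearIndependent_w <| by
    rw [← D.span_w, Submodule.span_le]
    rintro _ ⟨x, rfl⟩
    by_cases h : x.2 < D.c x.1
    · exact Submodule.subset_span ⟨⟨x, h⟩, rfl⟩
    · simp only [SetLike.mem_coe]
      rw [(D.w_eq_zero _ _).2 (not_lt.1 h)]
      exact zero_mem _

theorem basis_apply (x : {x : ZMod N × ℕ // x.2 < D.c x.1}) : D.basis x = D.w x.1.1 x.1.2 := by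
  simp [basis]

@[elab_as_elim]
theorem induction_on (D : NakayamaDatum k A N) {P : A → Prop} (x : A) (path : ∀ i l, P (D.w i l))
    (add : ∀ x y, P x → P y → P (x + y)) (smul : ∀ (r : k) x, P x → P (r • x)) : P x := by
  have hx : x ∈ Submodule.span k (Set.range fun x : ZMod N × ℕ => D.w x.1 x.2) := by
    rw [D.span_w]; trivial
  refine Submodule.span_induction (p := fun x _ => P x) ?_ ?_ (fun x y _ _ => add x y)
    (fun r x _ => smul r x) hx
  · rintro _ ⟨x, rfl⟩
    exact path _ _
  · simpa using smul 0 _ (path 0 0)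

/-! ### Interval modules -/

/-- The endpoints of the interval modules over `A`. -/
structure Interval where
  /-- the start -/
  a : ℤ
  /-- the end, which does not belong to the interval -/
  b : ℤ
  le : a ≤ b
  le_p : b ≤ D.p a

variable {D}

/-- The underlying `k`-vector space of an interval module: functions supported in `[a, b)`. -/
def Interval.functions (I : D.Interval) : Submodule k (ℤ → k) where
  carrier := {f | ∀ j, ¬(I.a ≤ j ∧ j < I.b) → f j = 0}
  add_mem' hf hg j hj := by simp [hf j hj, hg j hj]
  zero_mem' _ _ := rfl
  smul_mem' r f hf j hj := by simp [hf j hj]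

/-- The interval module `[a, b)`, a right module over `A`. -/
def Interval.Mod (I : D.Interval) : Type u := I.functions

namespace Interval

variable (I : D.Interval)

instance : AddCommGroup I.Mod := inferInstanceAs (AddCommGroup I.functions)

instance : Module k I.Mod := inferInstanceAs (Module k I.functions)

variable {I} in
/-- The values of an element of an interval module. -/
def eval (f : I.Mod) : ℤ → k := f.1

instance : CoeFun I.Mod fun _ => ℤ → k := ⟨eval⟩

variable {I}

@[ext]
theorem ext {f g : I.Mod} (h : ∀ j, f j = g j) : f = g := Subtype.ext (funext h)

@[simp] theorem add_apply (f g : I.Mod) (j : ℤ) : (f + g) j = f j + g j := rfl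

@[simp] theorem zero_apply (j : ℤ) : (0 : I.Mod) j = 0 := rfl

@[simp] theorem smul_apply (r : k) (f : I.Mod) (j : ℤ) : (r • f) j = r * f j := rfl

theorem apply_eq_zero (f : I.Mod) {j : ℤ} (hj : ¬(I.a ≤ j ∧ j < I.b)) : f j = 0 := f.2 j hj

theorem apply_of_lt (f : I.Mod) {j : ℤ} (hj : j < I.a) : f j = 0 := f.2 j (by omega)

theorem apply_of_ge (f : I.Mod) {j : ℤ} (hj : I.b ≤ j) : f j = 0 := f.2 j (by omega)

theorem sum_apply {ι : Type*} (s : Finset ι) (f : ι → I.Mod) (j : ℤ) :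
    (∑ i ∈ s, f i) j = ∑ i ∈ s, f i j := by
  classical
  induction s using Finset.induction_on with
  | empty => simp
  | insert i s hi ih => rw [Finset.sum_insert hi, Finset.sum_insert hi, add_apply, ih]

/-- An element of an interval module from its values. -/
def mk' (I : D.Interval) (f : ℤ → k) : I.Mod :=
  ⟨fun j => if I.a ≤ j ∧ j < I.b then f j else 0, fun _ hj => if_neg hj⟩

theorem mk'_apply (f : ℤ → k) (j : ℤ) :
    mk' I f j = if I.a ≤ j ∧ j < I.b then f j else 0 := rfl

variable (I) in
/-- The action of the path `w i l` on an interval module. -/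
def shift (i : ZMod N) (l : ℕ) : Module.End k I.Mod where
  toFun f := mk' I fun j => if ((j - l : ℤ) : ZMod N) = i then f (j - l) else 0
  map_add' f g := by
    ext j
    simp only [mk'_apply, add_apply]
    split_ifs <;> simp
  map_smul' r f := by
    ext j
    simp only [mk'_apply, smul_apply, RingHom.id_apply]
    split_ifs <;> simp

theorem shift_apply (i : ZMod N) (l : ℕ) (f : I.Mod) (j : ℤ) :
    I.shift i l f j = if j < I.b ∧ ((j - l : ℤ) : ZMod N) = i then f (j - l) else 0 := by
  change mk' I _ j = _
  rw [mk'_apply]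
  by_cases h1 : I.a ≤ j
  · simp only [h1, true_and]
    split_ifs <;> simp_all
  · rw [if_neg (by omega), apply_of_lt f (j := j - l) (by omega), ite_self]

/-- If `j - l` were in the interval, monotonicity would give `b ≤ p a ≤ p (j - l) ≤ j`, so `j` would
lie outside. This lets the action be defined on the basis of nonzero paths and still be given by
`shift` on every path. -/
theorem shift_eq_zero {i : ZMod N} {l : ℕ} (h : D.c i ≤ l) : I.shift i l = 0 := by
  ext f j
  rw [shift_apply]
  split_ifs with hj
  · refine apply_of_lt f ?_
    by_contra! h1
    have h2 := D.p_monotone h1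
    have h3 := I.le_p
    simp only [p] at h2 h3
    rw [hj.2] at h2
    omega
  · rfl

variable (I) in
/-- The right action of `A` on an interval module. -/
def act : A →ₗ[k] Module.End k I.Mod := D.basis.constr k fun x => I.shift x.1.1 x.1.2

theorem act_w (i : ZMod N) (l : ℕ) : I.act (D.w i l) = I.shift i l := by
  by_cases h : l < D.c i
  · rw [← D.basis_apply ⟨(i, l), h⟩, act, Module.Basis.constr_basis]
  · rw [(D.w_eq_zero i l).2 (not_lt.1 h), map_zero, shift_eq_zero (not_lt.1 h)]

theorem act_mul (x y : A) : I.act (x * y) = I.act y * I.act x := by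
  induction x using D.induction_on with
  | add x x' hx hx' => rw [add_mul, map_add, map_add, mul_add, hx, hx']
  | smul r x hx => rw [smul_mul_assoc, map_smul, map_smul, mul_smul_comm, hx]
  | path i l =>
  induction y using D.induction_on with
  | add x x' hx hx' => rw [mul_add, map_add, map_add, add_mul, hx, hx']
  | smul r x hx => rw [mul_smul_comm, map_smul, map_smul, smul_mul_assoc, hx]
  | path i' l' =>
  rw [D.mul_w, act_w, act_w]
  ext f j
  rw [Module.End.mul_apply, shift_apply, shift_apply]
  have e : j - ((l + l' : ℕ) : ℤ) = j - l' - l := by push_cast; ring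
  by_cases hj : j < I.b
  · have hj' : j - l' < I.b := by omega
    simp only [hj, hj', true_and]
    by_cases hi : ((j - l' - l : ℤ) : ZMod N) = i
    · rw [if_pos hi]
      have hi' : ((j - l' : ℤ) : ZMod N) = i + l := by rw [← hi]; push_cast; ring
      rw [hi']
      split_ifs with h1 h2 h2
      · rw [act_w, shift_apply, e, if_pos ⟨hj, hi⟩]
      · exact absurd h1.symm h2
      · exact absurd h2.symm h1
      · simp
    · rw [if_neg hi, ite_self]
      split_ifs
      · rw [act_w, shift_apply, e, if_neg fun h => hi h.2]
      · simp
  · rw [if_neg (c := j < I.b ∧ ((j - l' : ℤ) : ZMod N) = i') fun h => hj h.1]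
    split_ifs
    · rw [act_w, shift_apply, if_neg fun h => hj h.1]
    · simp

theorem act_one : I.act 1 = 1 := by
  rw [← D.sum_w, map_sum]
  ext f j
  simp only [act_w, LinearMap.sum_apply, sum_apply, shift_apply, Module.End.one_apply]
  by_cases hj : j < I.b
  · simp [hj]
  · simp [hj, apply_of_ge f (not_lt.1 hj)]

instance : Module Aᵐᵒᵖ I.Mod where
  smul x f := I.act x.unop f
  one_smul f := by
    change I.act 1 f = f
    rw [act_one]; rfl
  mul_smul x y f := by
    change I.act (y.unop * x.unop) f = I.act x.unop (I.act y.unop f)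
    rw [act_mul]; rfl
  smul_zero x := map_zero (I.act x.unop)
  smul_add x f g := map_add (I.act x.unop) f g
  add_smul x y f := by
    change I.act (x.unop + y.unop) f = I.act x.unop f + I.act y.unop f
    rw [map_add]; rfl
  zero_smul f := by
    change I.act 0 f = 0
    rw [map_zero]; rfl

theorem op_smul_def (x : A) (f : I.Mod) : op x • f = I.act x f := rfl

instance : IsScalarTower k Aᵐᵒᵖ I.Mod where
  smul_assoc r x f := by
    change I.act (r • x.unop) f = r • I.act x.unop f
    rw [map_smul]; rfl

theorem op_w_smul_apply (i : ZMod N) (l : ℕ) (f : I.Mod) (j : ℤ) :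
    (op (D.w i l) • f) j =
      if j < I.b ∧ ((j - l : ℤ) : ZMod N) = i then f (j - l) else 0 := by
  rw [op_smul_def, act_w, shift_apply]

variable (I) in
/-- The basis element of an interval module that belongs to a vertex. -/
def gen (j : ℤ) : I.Mod := mk' I (Pi.single j 1)

theorem gen_apply (j j' : ℤ) :
    I.gen j j' = if j' = j ∧ I.a ≤ j ∧ j < I.b then 1 else 0 := by
  rw [gen, mk'_apply, Pi.single_apply]
  by_cases h : j' = j
  · subst h; simp
  · simp [h]

theorem gen_of_ge {j : ℤ} (h : I.b ≤ j) : I.gen j = 0 := by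
  ext j'
  rw [gen_apply, if_neg (by omega), zero_apply]

theorem op_w_smul_gen (i : ZMod N) (l : ℕ) {j : ℤ} (hj : I.a ≤ j) :
    op (D.w i l) • I.gen j = if (j : ZMod N) = i then I.gen (j + l) else 0 := by
  ext j'
  rw [op_w_smul_apply, gen_apply]
  by_cases h : j' = j + l
  · subst h
    simp only [add_sub_cancel_right, true_and]
    by_cases h1 : (j : ZMod N) = i
    · simp only [h1, and_true, if_true, gen_apply, true_and]
      split_ifs <;> first | rfl | omega
    · simp [h1]
  · rw [if_neg (show ¬(j' - l = j ∧ _) by omega), ite_self]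
    split_ifs
    · rw [gen_apply, if_neg (by omega)]
    · rfl

theorem sum_gen (f : I.Mod) : ∑ j ∈ Finset.Ico I.a I.b, f j • I.gen j = f := by
  ext j'
  rw [sum_apply]
  simp only [smul_apply, gen_apply]
  by_cases h : I.a ≤ j' ∧ j' < I.b
  · rw [Finset.sum_eq_single j']
    · simp [h]
    · intro j _ hj
      rw [if_neg (by omega), mul_zero]
    · intro h'
      exact absurd (Finset.mem_Ico.2 h) h'
  · rw [apply_eq_zero f h]
    refine Finset.sum_eq_zero fun j hj => ?_
    rw [Finset.mem_Ico] at hj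
    rw [if_neg (by omega), mul_zero]

end Interval

variable (D) in
/-- A `k`-linear map that commutes with the action of all paths is `A`-linear. -/
def linearMapOfCommutes {M M' : Type*} [AddCommGroup M] [AddCommGroup M'] [Module k M]
    [Module k M'] [Module Aᵐᵒᵖ M] [Module Aᵐᵒᵖ M'] [IsScalarTower k Aᵐᵒᵖ M]
    [IsScalarTower k Aᵐᵒᵖ M'] (φ : M →ₗ[k] M')
    (h : ∀ i l m, φ (op (D.w i l) • m) = op (D.w i l) • φ m) : M →ₗ[Aᵐᵒᵖ] M' where
  toFun := φ
  map_add' := map_add φ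
  map_smul' x m := by
    obtain ⟨x, rfl⟩ := op_surjective x
    rw [RingHom.id_apply]
    induction x using D.induction_on with
    | add x y hx hy => rw [op_add, add_smul, add_smul, map_add, hx, hy]
    | smul r x hx => rw [op_smul, smul_assoc, smul_assoc, map_smul, hx]
    | path i l => exact h i l m

instance : IsScalarTower k Aᵐᵒᵖ A where
  smul_assoc r x y := by
    obtain ⟨x, rfl⟩ := op_surjective x
    rw [← op_smul, op_smul_eq_mul, op_smul_eq_mul, mul_smul_comm]

end

end NakayamaDatum

open CategoryTheory

namespace NakayamaDatum

open MulOpposite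

noncomputable section

variable {k : Type u} [Field k] {A : Type u} [Ring A] [Algebra k A] {N : ℕ} [NeZero N]
  {D : NakayamaDatum k A N}

/-! ### Canonical maps and short exact sequences of interval modules -/

namespace Interval

/-- The canonical homomorphism between interval modules. -/
def map (I J : D.Interval) (ha : J.a ≤ I.a) (hb : J.b ≤ I.b) : I.Mod →ₗ[Aᵐᵒᵖ] J.Mod :=
  D.linearMapOfCommutes
    { toFun := fun f => mk' J f
      map_add' := fun f g => by
        ext j
        simp only [mk'_apply, add_apply]
        split_ifs <;> simp
      map_smul' := fun r f => by
        ext j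
        simp only [mk'_apply, smul_apply, RingHom.id_apply]
        split_ifs <;> simp }
    fun i l f => by
      ext j
      simp only [LinearMap.coe_mk, AddHom.coe_mk, mk'_apply, op_w_smul_apply]
      by_cases h1 : J.a ≤ j - l
      · by_cases h2 : j < J.b
        · have h3 : J.a ≤ j := by omega
          have h4 : j < I.b := by omega
          have h5 : j - l < J.b := by omega
          simp only [h1, h2, h3, h4, h5, true_and, if_true]
        · simp only [h2, and_false, false_and, if_false]
      · rw [apply_of_lt f (j := j - l) (by omega)]
        simp

section

variable {I J : D.Interval} {ha : J.a ≤ I.a} {hb : J.b ≤ I.b}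

theorem map_apply (f : I.Mod) (j : ℤ) : map I J ha hb f j = if j < J.b then f j else 0 := by
  change mk' J f j = _
  rw [mk'_apply]
  by_cases h : J.a ≤ j
  · simp [h]
  · rw [if_neg (by omega), apply_of_lt f (by omega), ite_self]

theorem map_injective (h : I.b ≤ J.b) : Function.Injective (map I J ha hb) := by
  intro f g hfg
  ext j
  have := congrArg (fun f : J.Mod => f j) hfg
  simp only [map_apply] at this
  split_ifs at this with h1
  · exact this
  · rw [apply_of_ge f (by omega), apply_of_ge g (by omega)]

theorem map_surjective (h : I.a ≤ J.a) : Function.Surjective (map I J ha hb) := by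
  intro g
  refine ⟨mk' I g, ?_⟩
  ext j
  rw [map_apply, mk'_apply]
  split_ifs with h1 h2
  · rfl
  · rw [apply_eq_zero g (by omega)]
  · rw [apply_of_ge g (by omega)]

end

/-- Elements of `J` that vanish on the initial piece `K` are supported on the final piece `I`. This
one statement yields both the syzygy and the cosyzygy sequences. -/
theorem map_exact (I J K : D.Interval) (h1 : J.a ≤ I.a) (h2 : J.b = I.b) (h3 : K.a = J.a)
    (h4 : K.b = I.a) (hb : J.b ≤ I.b) (hb' : K.b ≤ J.b) :
    Function.Exact (map I J h1 hb) (map J K h3.le hb') := by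
  intro g
  constructor
  · intro hg
    refine ⟨mk' I g, ?_⟩
    ext j
    rw [map_apply, mk'_apply]
    have := congrArg (fun f : K.Mod => f j) hg
    simp only [map_apply, zero_apply] at this
    by_cases h5 : j < J.b
    · rw [if_pos h5]
      by_cases h6 : I.a ≤ j
      · rw [if_pos (by omega)]
      · rw [if_neg (by omega), ← this, if_pos (by omega)]
    · rw [if_neg h5, apply_of_ge g (by omega)]
  · rintro ⟨f, rfl⟩
    ext j
    rw [map_apply, zero_apply]
    split_ifs with h
    · rw [map_apply, apply_of_lt f (by omega), ite_self]
    · rfl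

/-! ### Projective interval modules -/

variable (D) in
/-- The projective interval. -/
def proj (a : ℤ) : D.Interval := ⟨a, D.p a, D.le_p a, le_rfl⟩

/-- The coordinates of an interval module. -/
def coord (I : D.Interval) (j : ℤ) : I.Mod →ₗ[k] k where
  toFun f := f j
  map_add' _ _ := rfl
  map_smul' _ _ := rfl

/-- The `k`-linear map from `[a, b)` to `A` that sends the basis elements to paths. -/
def toRegularAux (I : D.Interval) : I.Mod →ₗ[k] A :=
  ∑ j ∈ Finset.Ico I.a I.b, (I.coord j).smulRight (D.w I.a (j - I.a).toNat)

theorem toRegularAux_apply (I : D.Interval) (f : I.Mod) :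
    I.toRegularAux f = ∑ j ∈ Finset.Ico I.a I.b, f j • D.w I.a (j - I.a).toNat := by
  rw [toRegularAux, LinearMap.sum_apply]
  rfl

theorem toRegularAux_gen (I : D.Interval) (h : I.b = D.p I.a) {j : ℤ} (hj : I.a ≤ j) :
    I.toRegularAux (I.gen j) = D.w I.a (j - I.a).toNat := by
  by_cases hb : j < I.b
  · rw [toRegularAux_apply, Finset.sum_eq_single j]
    · rw [gen_apply, if_pos ⟨rfl, hj, hb⟩, one_smul]
    · intro j' _ hj'
      rw [gen_apply, if_neg (by tauto), zero_smul]
    · intro h'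
      exact absurd (Finset.mem_Ico.2 ⟨hj, hb⟩) h'
  · rw [gen_of_ge (not_lt.1 hb), map_zero, (D.w_eq_zero _ _).2]
    rw [h, p] at hb
    omega

/-- The embedding of a projective interval module into `A`. -/
def toRegular (I : D.Interval) (h : I.b = D.p I.a) : I.Mod →ₗ[Aᵐᵒᵖ] A :=
  D.linearMapOfCommutes I.toRegularAux fun i l f => by
    rw [← sum_gen f, Finset.smul_sum, map_sum, map_sum, Finset.smul_sum]
    refine Finset.sum_congr rfl fun j hj => ?_
    rw [Finset.mem_Ico] at hj
    rw [smul_comm (op _) (f j) (I.gen j), LinearMap.map_smul, LinearMap.map_smul,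
      smul_comm (op _) (f j), op_w_smul_gen _ _ hj.1, toRegularAux_gen I h hj.1, op_smul_eq_mul,
      D.mul_w]
    congr 1
    have e : (I.a : ZMod N) + (((j - I.a).toNat : ℕ) : ZMod N) = (j : ZMod N) := by
      rw [← Int.cast_natCast, Int.toNat_of_nonneg (by omega)]
      push_cast; ring
    rw [e]
    by_cases h1 : (j : ZMod N) = i
    · rw [if_pos h1, if_pos h1.symm, toRegularAux_gen I h (by omega)]
      congr 1
      omega
    · rw [if_neg h1, if_neg (Ne.symm h1), map_zero]

theorem toRegular_apply (I : D.Interval) (h : I.b = D.p I.a) (f : I.Mod) :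
    I.toRegular h f = ∑ j ∈ Finset.Ico I.a I.b, f j • D.w I.a (j - I.a).toNat :=
  I.toRegularAux_apply f

/-- The action on the generator. -/
def fromRegular (I : D.Interval) : A →ₗ[Aᵐᵒᵖ] I.Mod where
  toFun x := op x • I.gen I.a
  map_add' x y := by rw [MulOpposite.op_add, add_smul]
  map_smul' x y := by
    obtain ⟨x, rfl⟩ := op_surjective x
    rw [op_smul_eq_mul, MulOpposite.op_mul, mul_smul, RingHom.id_apply]

theorem fromRegular_w (I : D.Interval) (i : ZMod N) (l : ℕ) :
    I.fromRegular (D.w i l) = if (I.a : ZMod N) = i then I.gen (I.a + l) else 0 :=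
  op_w_smul_gen i l le_rfl

theorem fromRegular_smul (I : D.Interval) (r : k) (x : A) :
    I.fromRegular (r • x) = r • I.fromRegular x := by
  change op (r • x) • I.gen I.a = r • op x • I.gen I.a
  rw [MulOpposite.op_smul, smul_assoc]

theorem fromRegular_mul (I : D.Interval) (x y : A) :
    I.fromRegular (x * y) = op y • I.fromRegular x := by
  rw [← map_smul, op_smul_eq_mul]

theorem fromRegular_toRegular (I : D.Interval) (h : I.b = D.p I.a) (f : I.Mod) :
    I.fromRegular (I.toRegular h f) = f := by
  rw [toRegular_apply, map_sum]
  conv_rhs => rw [← sum_gen f]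
  refine Finset.sum_congr rfl fun j hj => ?_
  rw [Finset.mem_Ico] at hj
  rw [fromRegular_smul, fromRegular_w, if_pos rfl]
  congr 2
  omega

theorem toRegular_fromRegular (I : D.Interval) (h : I.b = D.p I.a) (x : A) :
    I.toRegular h (I.fromRegular x) = D.w I.a 0 * x := by
  change I.toRegular h (op x • I.gen I.a) = _
  rw [map_smul, op_smul_eq_mul]
  congr 1
  refine (toRegularAux_gen I h le_rfl).trans ?_
  simp

/-- The image of `toRegular` lies in the right ideal generated by the idempotent at `J.a`, and that
idempotent annihilates the generator of `I`. -/
theorem fromRegular_toRegular_of_ne (I J : D.Interval) (h : J.b = D.p J.a)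
    (hne : (I.a : ZMod N) ≠ J.a) (f : J.Mod) : I.fromRegular (J.toRegular h f) = 0 := by
  rw [← fromRegular_toRegular J h f, toRegular_fromRegular, fromRegular_mul, fromRegular_w,
    if_neg hne, smul_zero]

theorem projective (I : D.Interval) (h : I.b = D.p I.a) : Module.Projective Aᵐᵒᵖ I.Mod := by
  have : Module.Projective Aᵐᵒᵖ A := by
    refine Module.Projective.of_equiv' (P := A) (M := Aᵐᵒᵖ)
      { toFun := unop, invFun := op, left_inv := fun _ => rfl, right_inv := fun _ => rfl,
        map_add' := fun _ _ => rfl, map_smul' := fun _ _ => rfl }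
  exact Module.Projective.of_split (I.toRegular h) I.fromRegular
    (LinearMap.ext (fromRegular_toRegular I h))

/-- A section of `[a, p a) → [a, b)` would send the generator to an element with coefficient `1` at
`a`. The path of length `b - a` kills the generator, but it moves that coefficient to position `b`,
which lies inside `[a, p a)` if `b < p a`. -/
theorem eq_of_projective (I : D.Interval) [hP : Module.Projective Aᵐᵒᵖ I.Mod] :
    I.a = I.b ∨ I.b = D.p I.a := by
  by_contra! hne
  have h1 : I.a < I.b := lt_of_le_of_ne I.le hne.1
  have h2 : I.b < D.p I.a := lt_of_le_of_ne I.le_p hne.2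
  obtain ⟨P, hPa, hPb⟩ : ∃ P : D.Interval, P.a = I.a ∧ P.b = D.p I.a := ⟨proj D I.a, rfl, rfl⟩
  have hb : I.b ≤ P.b := hPb ▸ I.le_p
  obtain ⟨σ, hσ⟩ := LinearMap.exists_rightInverse_of_surjective (map P I hPa.ge hb)
    (LinearMap.range_eq_top.2 (map_surjective hPa.le))
  have h3 : map P I hPa.ge hb (σ (I.gen I.a)) = I.gen I.a := LinearMap.congr_fun hσ _
  have h4 := congrArg (fun f : I.Mod => f I.a) h3
  rw [map_apply, if_pos h1, gen_apply, if_pos ⟨rfl, le_rfl, h1⟩] at h4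
  have h5 : op (D.w I.a (I.b - I.a).toNat) • I.gen I.a = 0 := by
    rw [op_w_smul_gen _ _ le_rfl, if_pos rfl, gen_of_ge (by omega)]
  have h6 := congrArg (fun f : P.Mod => f I.b) (congrArg σ h5)
  simp only [map_smul, map_zero, zero_apply] at h6
  have h7 : I.b - ((I.b - I.a).toNat : ℤ) = I.a := by omega
  rw [op_w_smul_apply, h7, if_pos ⟨hPb ▸ h2, rfl⟩, h4] at h6
  exact one_ne_zero h6

/-! ### Injective interval modules -/

/-- The homomorphism to an injective interval module that belongs to a linear form. -/
def ofDual (I : D.Interval) (h : I.a = D.q I.b) {X : Type*} [AddCommGroup X] [Module k X]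
    [Module Aᵐᵒᵖ X] [IsScalarTower k Aᵐᵒᵖ X] (φ : X →ₗ[k] k) : X →ₗ[Aᵐᵒᵖ] I.Mod :=
  D.linearMapOfCommutes
    -- The last coordinate of a homomorphism determines it: the path from `j` to `b - 1` carries
    -- coordinate `j` into the last one.
    { toFun := fun x => mk' I fun j => φ (op (D.w j (I.b - 1 - j).toNat) • x)
      map_add' := fun x y => by
        ext j
        simp only [mk'_apply, add_apply, smul_add, map_add]
        split_ifs <;> simp
      map_smul' := fun r x => by
        ext j
        simp only [mk'_apply, smul_apply, RingHom.id_apply]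
        rw [smul_comm, map_smul, smul_eq_mul]
        split_ifs <;> simp }
    fun i l x => by
      ext j
      rw [op_w_smul_apply]
      simp only [LinearMap.coe_mk, AddHom.coe_mk, mk'_apply, smul_smul, ← MulOpposite.op_mul, D.mul_w]
      by_cases h2 : j < I.b
      · have e : ((j - l : ℤ) : ZMod N) = i ↔ (j : ZMod N) = i + l := by
          push_cast
          exact sub_eq_iff_eq_add
        simp only [h2, e, and_true, true_and]
        by_cases h3 : (j : ZMod N) = i + l
        · rw [if_pos h3]
          have h4 : ((j - l : ℤ) : ZMod N) = i := e.2 h3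
          by_cases h5 : I.a ≤ j - l
          · rw [if_pos (by omega), if_pos h3, if_pos (by omega), h4]
            congr 4
            omega
          · rw [if_neg (c := I.a ≤ j - l ∧ _) (by omega), ite_self, ite_eq_right_iff]
            intro h6
            -- Here `I.a = q b` is used: from a position before `q b`, the path to `b - 1` is
            -- already zero.
            have h7 : D.p (j - l) < I.b := by
              rw [← not_le, ← D.gc, ← h]
              exact h5
            rw [(D.w_eq_zero _ _).2, op_zero, zero_smul, map_zero]
            rw [p, h4] at h7
            omega
        · simp [h3]
      · simp [h2]

theorem ofDual_apply (I : D.Interval) (h : I.a = D.q I.b) {X : Type*} [AddCommGroup X]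
    [Module k X] [Module Aᵐᵒᵖ X] [IsScalarTower k Aᵐᵒᵖ X] (φ : X →ₗ[k] k) (x : X) (j : ℤ) :
    I.ofDual h φ x j = if I.a ≤ j ∧ j < I.b then
      φ (op (D.w j (I.b - 1 - j).toNat) • x) else 0 := rfl

/-- By Baer's criterion, maps from right ideals have to be extended. Taking the last coordinate
reduces this to extending a linear form over `k`, and `ofDual` rebuilds the module homomorphism. -/
theorem injective (I : D.Interval) (h : I.a = I.b ∨ I.a = D.q I.b) :
    Module.Injective Aᵐᵒᵖ I.Mod := by
  refine Module.Baer.injective fun J g => ?_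
  rcases h with h | h
  · refine ⟨0, fun x mem => ?_⟩
    ext j
    rw [apply_eq_zero _ (by omega), apply_eq_zero _ (by omega)]
  let φ : J →ₗ[k] k :=
    { toFun := fun x => g x (I.b - 1)
      map_add' := fun x y => by rw [map_add, add_apply]
      map_smul' := fun r x => by
        have : r • x = (r • (1 : Aᵐᵒᵖ)) • x := by rw [smul_assoc, one_smul]
        rw [RingHom.id_apply, this, map_smul, smul_assoc, one_smul, smul_apply, smul_eq_mul] }
  obtain ⟨ψ, hψ⟩ := LinearMap.exists_extend (p := J.restrictScalars k) φ
  refine ⟨I.ofDual h ψ, fun x mem => ?_⟩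
  ext j
  rw [ofDual_apply]
  split_ifs with hj
  · have h1 : ψ (op (D.w j (I.b - 1 - j).toNat) • x) =
        φ (op (D.w j (I.b - 1 - j).toNat) • ⟨x, mem⟩) :=
      LinearMap.congr_fun hψ (op (D.w j (I.b - 1 - j).toNat) • ⟨x, mem⟩ : J)
    have h2 : I.b - 1 - ((I.b - 1 - j).toNat : ℤ) = j := by omega
    rw [h1]
    change g _ (I.b - 1) = _
    rw [map_smul, op_w_smul_apply, h2, if_pos ⟨by omega, rfl⟩]
  · rw [apply_eq_zero _ hj]

end Interval

/-! ### Finite direct sums of interval modules -/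

variable {ι : Type}

theorem pi_projective_iff [Finite ι] (F : ι → D.Interval) :
    Module.Projective Aᵐᵒᵖ (∀ s, (F s).Mod) ↔ ∀ s, (F s).a = (F s).b ∨ (F s).b = D.p (F s).a := by
  classical
  have := Fintype.ofFinite ι
  constructor
  · intro _ s
    have : Module.Projective Aᵐᵒᵖ (F s).Mod :=
      Module.Projective.of_split (LinearMap.single Aᵐᵒᵖ (fun s => (F s).Mod) s)
        (LinearMap.proj s) (by ext; simp)
    exact (F s).eq_of_projective
  · intro h
    have h1 : ∀ s, Module.Projective Aᵐᵒᵖ (F s).Mod := by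
      intro s
      rcases h s with h | h
      · have : Subsingleton (F s).Mod := ⟨fun f g => by
          ext j
          rw [Interval.apply_eq_zero _ (by omega), Interval.apply_eq_zero _ (by omega)]⟩
        infer_instance
      · exact (F s).projective h
    exact Module.Projective.of_equiv' (DFinsupp.linearEquivFunOnFintype (R := Aᵐᵒᵖ)
      (M := fun s => (F s).Mod))

theorem pi_injective (F : ι → D.Interval)
    (h : ∀ s, (F s).a = (F s).b ∨ (F s).a = D.q (F s).b) :
    Module.Injective Aᵐᵒᵖ (∀ s, (F s).Mod) where
  out X Y _ _ _ _ f hf g := by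
    have h1 := fun s => ((F s).injective (h s)).out f hf (LinearMap.proj s ∘ₗ g)
    choose G hG using h1
    exact ⟨LinearMap.pi G, fun x => funext fun s => hG s x⟩

/-- The canonical homomorphism between direct sums of interval modules. -/
def piMap (F G : ι → D.Interval) (ha : ∀ s, (G s).a ≤ (F s).a) (hb : ∀ s, (G s).b ≤ (F s).b) :
    (∀ s, (F s).Mod) →ₗ[Aᵐᵒᵖ] ∀ s, (G s).Mod :=
  LinearMap.pi fun s => Interval.map (F s) (G s) (ha s) (hb s) ∘ₗ LinearMap.proj s

variable {F G H : ι → D.Interval} {ha : ∀ s, (G s).a ≤ (F s).a} {hb : ∀ s, (G s).b ≤ (F s).b}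

theorem piMap_apply (f : ∀ s, (F s).Mod) (s : ι) :
    piMap F G ha hb f s = Interval.map (F s) (G s) (ha s) (hb s) (f s) := rfl

theorem piMap_injective (h : ∀ s, (F s).b ≤ (G s).b) : Function.Injective (piMap F G ha hb) :=
  fun _ _ hfg => funext fun s => Interval.map_injective (ha := ha s) (hb := hb s) (h s) (congrFun hfg s)

theorem piMap_surjective (h : ∀ s, (F s).a ≤ (G s).a) :
    Function.Surjective (piMap F G ha hb) := by
  intro g
  choose f hf using fun s => Interval.map_surjective (hb := hb s) (ha := ha s) (h s) (g s)
  exact ⟨f, funext hf⟩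

theorem piMap_exact (h1 : ∀ s, (G s).a ≤ (F s).a) (h2 : ∀ s, (G s).b = (F s).b)
    (h3 : ∀ s, (H s).a = (G s).a) (h4 : ∀ s, (H s).b = (F s).a)
    (h5 : ∀ s, (H s).b ≤ (G s).b) :
    Function.Exact (piMap F G h1 fun s => (h2 s).le) (piMap G H (fun s => (h3 s).le) h5) := by
  have hex := fun s => Interval.map_exact (F s) (G s) (H s) (h1 s) (h2 s) (h3 s) (h4 s)
    (h2 s).le (h5 s)
  intro g
  constructor
  · intro hg
    choose f hf using fun s => (hex s (g s)).1 (congrFun hg s)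
    exact ⟨f, funext hf⟩
  · rintro ⟨f, rfl⟩
    exact funext fun s => (hex s _).2 ⟨f s, rfl⟩

theorem piMap_range_essential [Finite ι] (h1 : ∀ s, (G s).a ≤ (F s).a) (h2 : ∀ s, (G s).b = (F s).b)
    (h3 : ∀ s, (F s).a < (F s).b ∨ (G s).a = (G s).b) :
    IsEssentialSubmodule (LinearMap.range (piMap F G h1 fun s => (h2 s).le)) := by
  classical
  have := Fintype.ofFinite ι
  intro L hL
  rw [Submodule.eq_bot_iff]
  by_contra! hne
  obtain ⟨g, hgL, hg⟩ := hne
  obtain ⟨s₀, hs₀⟩ := Function.ne_iff.1 hg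
  obtain ⟨j₀, hj₀⟩ : ∃ j, g s₀ j ≠ 0 := by
    by_contra! h
    exact hs₀ (Interval.ext h)
  have hsupp : ∀ s j, g s j ≠ 0 → (G s).a ≤ j ∧ j < (G s).b := by
    intro s j h
    by_contra h'
    exact h ((g s).2 j h')
  -- Choose a nonzero coordinate farthest from the end of its interval, at distance `l`. Acting by
  -- the path of length `l` from there leaves only last coordinates, which belong to the range, and
  -- keeps the chosen one.
  obtain ⟨x, hx, hmax⟩ := Finset.exists_max_image
    ((Finset.univ.sigma fun s => Finset.Ico (G s).a (G s).b).filter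
      fun x : Σ _ : ι, ℤ => g x.1 x.2 ≠ 0)
    (fun x => (G x.1).b - 1 - x.2) ⟨⟨s₀, j₀⟩, by
      simp only [Finset.mem_filter, Finset.mem_sigma, Finset.mem_univ, true_and, Finset.mem_Ico]
      exact ⟨hsupp _ _ hj₀, hj₀⟩⟩
  obtain ⟨s, j⟩ := x
  simp only [Finset.mem_filter, Finset.mem_sigma, Finset.mem_univ, true_and, Finset.mem_Ico]
    at hx hmax
  set l := ((G s).b - 1 - j).toNat with hl
  have hl' : (l : ℤ) = (G s).b - 1 - j := by omega
  have hmax' : ∀ s' j', g s' j' ≠ 0 → (G s').b - 1 - j' ≤ l := by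
    intro s' j' h
    rw [hl']
    exact hmax ⟨s', j'⟩ ⟨hsupp _ _ h, h⟩
  have hmem : op (D.w j l) • g ∈ L := L.smul_mem _ hgL
  have hmem' : op (D.w j l) • g ∈ LinearMap.range (piMap F G h1 fun s => (h2 s).le) := by
    refine ⟨fun s' => Interval.mk' (F s') ((op (D.w j l) • g) s'), funext fun s' => ?_⟩
    rw [piMap_apply]
    ext j'
    rw [Interval.map_apply, Interval.mk'_apply]
    rw [Pi.smul_apply]
    by_cases h4 : (op (D.w j l) • g s') j' = 0
    · rw [h4, ite_self, ite_self]
    · rw [Interval.op_w_smul_apply] at h4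
      have h5 := (ite_ne_right_iff.1 h4)
      have h6 := hmax' s' _ h5.2
      have h7 := hsupp _ _ h5.2
      have h8 := h2 s'
      have h9 := h3 s'
      rw [if_pos (by omega), if_pos (by omega)]
  have hz : op (D.w j l) • g = 0 := by
    have : op (D.w j l) • g ∈ LinearMap.range (piMap F G h1 fun s => (h2 s).le) ⊓ L := ⟨hmem', hmem⟩
    rwa [hL, Submodule.mem_bot] at this
  have hz' : (op (D.w j l) • g s) (j + l) = 0 := congrArg (fun f : ∀ s, (G s).Mod => f s (j + l)) hz
  rw [Interval.op_w_smul_apply, add_sub_cancel_right, if_pos ⟨by omega, rfl⟩] at hz'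
  exact hx.2 hz'

/-! ### Projective dimension -/

/-- The projective dimension of a direct sum of interval modules. -/
theorem hasProjectiveDimensionLE_pi_iff [Finite ι] (n : ℕ) (F : ι → D.Interval) :
    HasProjectiveDimensionLE (ModuleCat.of Aᵐᵒᵖ (∀ s, (F s).Mod)) n ↔
      ∀ s, Nakayama.PdLE D.p n (F s).a (F s).b := by
  induction n generalizing F with
  | zero =>
    rw [← projective_iff_hasProjectiveDimensionLE_zero, ← IsProjective.iff_projective,
      pi_projective_iff]
    rfl
  | succ n ih =>
    -- The cover need not be minimal: dimension shifting works for any projective `P`, so empty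
    -- intervals require no separate treatment.
    let P : ι → D.Interval := fun s => Interval.proj D (F s).a
    let S : ι → D.Interval := fun s => ⟨(F s).b, D.p (F s).a, (F s).le_p, D.p_monotone (F s).le⟩
    have hb : ∀ s, (P s).b = (S s).b := fun _ => rfl
    have hP : Module.Projective Aᵐᵒᵖ (∀ s, (P s).Mod) :=
      (pi_projective_iff P).2 fun s => Or.inr rfl
    have hex := piMap_exact (F := S) (G := P) (H := F) (fun s => (F s).le) hb (fun _ => rfl)
      (fun _ => rfl) (fun s => (F s).le_p)
    have hS := ModuleCat.shortComplex_shortExact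
      (ShortComplex.mk (ModuleCat.ofHom (piMap S P (fun s => (F s).le) fun s => (hb s).le))
        (ModuleCat.ofHom (piMap P F (fun _ => le_rfl) fun s => (F s).le_p)) (by
          ext1
          exact hex.linearMap_comp_eq_zero))
      hex (piMap_injective fun s => le_rfl) (piMap_surjective fun s => le_rfl)
    have := hS.hasProjectiveDimensionLT_X₃_iff n (by
      dsimp only
      exact (IsProjective.iff_projective _).1 hP)
    exact this.trans (ih S)

/-! ### The regular module -/

/-- The projective intervals that correspond to the vertices. -/
def regularInterval (D : NakayamaDatum k A N) (x : ZMod N) : D.Interval :=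
  Interval.proj D (x.val : ℤ)

theorem regularInterval_a (x : ZMod N) : ((D.regularInterval x).a : ZMod N) = x := by
  simp [regularInterval, Interval.proj]

theorem regularInterval_b (x : ZMod N) : (D.regularInterval x).b = D.p (D.regularInterval x).a :=
  rfl

/-- The decomposition of the regular right module. -/
def regularEquiv (D : NakayamaDatum k A N) :
    A ≃ₗ[Aᵐᵒᵖ] ∀ x : ZMod N, (D.regularInterval x).Mod :=
  LinearEquiv.ofBijective (LinearMap.pi fun x : ZMod N => (D.regularInterval x).fromRegular) <| by
    constructor
    · rw [injective_iff_map_eq_zero]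
      intro x hx
      -- Each component `w i 0 * x` is recovered from the image of `x` in the `i`-th interval
      -- module.
      rw [← one_mul x, ← D.sum_w, Finset.sum_mul]
      refine Finset.sum_eq_zero fun i _ => ?_
      have h : (D.regularInterval i).fromRegular x = 0 := congrFun hx i
      have h' := Interval.toRegular_fromRegular _ (regularInterval_b (D := D) i) x
      rw [h, map_zero, regularInterval_a] at h'
      exact h'.symm
    · intro g
      refine ⟨∑ x : ZMod N, (D.regularInterval x).toRegular (regularInterval_b x) (g x), ?_⟩
      ext i : 1
      rw [LinearMap.pi_apply, map_sum, Finset.sum_eq_single i]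
      · exact Interval.fromRegular_toRegular _ _ _
      · intro j _ hj
        refine Interval.fromRegular_toRegular_of_ne _ _ _ ?_ _
        rw [regularInterval_a, regularInterval_a]
        exact hj.symm
      · intro h
        exact absurd (Finset.mem_univ i) h

end

end NakayamaDatum

/-! ### Minimal injective resolutions -/

section MinimalResolution

variable {R : Type u} [Ring R]

/-- Injective envelopes are unique. -/
theorem exists_equiv_of_essential {E X Z : Type u} [AddCommGroup E] [AddCommGroup X]
    [AddCommGroup Z] [Module R E] [Module R X] [Module R Z] {K : Submodule R E}
    (hK : IsEssentialSubmodule K) (hE : Module.Injective R E) (hX : Module.Injective R X)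
    (e : K ≃ₗ[R] Z) {i : Z →ₗ[R] X} (hi : Function.Injective i)
    (hi' : IsEssentialSubmodule (LinearMap.range i)) :
    ∃ φ : E ≃ₗ[R] X, ∀ x : K, φ x = i (e x) := by
  -- Extend the embedding of `K` to `E`. The kernel of the extension meets the essential `K`
  -- trivially, so the extension is injective.
  obtain ⟨φ, hφ⟩ := hX.out K.subtype K.injective_subtype (i ∘ₗ e.toLinearMap)
  have hφi : Function.Injective φ := by
    rw [← LinearMap.ker_eq_bot]
    refine hK _ ?_
    rw [Submodule.eq_bot_iff]
    rintro x ⟨hx, hx'⟩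
    have h1 : i (e ⟨x, hx⟩) = 0 := (hφ ⟨x, hx⟩).symm.trans hx'
    rw [← map_zero i, hi.eq_iff, EmbeddingLike.map_eq_zero_iff] at h1
    exact congrArg Subtype.val h1
  -- Injectivity of `E` gives a retraction of `φ`. Its kernel meets the essential range of `i`
  -- trivially, hence vanishes, and `φ` is onto.
  obtain ⟨ψ, hψ⟩ := hE.out φ hφi LinearMap.id
  have hψi : LinearMap.ker ψ = ⊥ := by
    refine hi' _ ?_
    rw [Submodule.eq_bot_iff]
    rintro _ ⟨⟨z, rfl⟩, hx'⟩
    obtain ⟨x, rfl⟩ := e.surjective z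
    have h2 : φ x = i (e x) := hφ x
    have h1 : (x : E) = 0 := by
      rw [← LinearMap.id_apply (R := R) (x : E), ← hψ, h2]
      exact hx'
    rw [← h2, h1, map_zero]
  have hφs : Function.Surjective φ := fun x =>
    ⟨ψ x, LinearMap.ker_eq_bot.1 hψi (hψ (ψ x))⟩
  exact ⟨LinearEquiv.ofBijective φ ⟨hφi, hφs⟩, hφ⟩

/-- The successive cosyzygies of a minimal injective resolution. -/
structure CosyzygyData (R : Type u) [Ring R] where
  /-- the cosyzygies -/
  Z : ℕ → Type u
  /-- the injective envelopes -/
  X : ℕ → Type u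
  [addCommGroupZ : ∀ j, AddCommGroup (Z j)]
  [addCommGroupX : ∀ j, AddCommGroup (X j)]
  [moduleZ : ∀ j, Module R (Z j)]
  [moduleX : ∀ j, Module R (X j)]
  /-- the embeddings -/
  i : ∀ j, Z j →ₗ[R] X j
  /-- the projections -/
  π : ∀ j, X j →ₗ[R] Z (j + 1)
  i_injective : ∀ j, Function.Injective (i j)
  π_surjective : ∀ j, Function.Surjective (π j)
  exact : ∀ j, Function.Exact (i j) (π j)
  injective : ∀ j, Module.Injective R (X j)
  essential : ∀ j, IsEssentialSubmodule (LinearMap.range (i j))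

namespace CosyzygyData

attribute [instance] addCommGroupZ addCommGroupX moduleZ moduleX

variable (S : CosyzygyData R) {M : ModuleCat.{u} R}

/-- The terms of a minimal injective resolution are determined up to isomorphism. -/
theorem nonempty_equiv (E : InjectiveResolution M) (hE : IsMinimalInjectiveResolution E)
    (e : M ≃ₗ[R] S.Z 0) (j : ℕ) : Nonempty (E.cocomplex.X j ≃ₗ[R] S.X j) := by
  have hinj : ∀ j, Module.Injective R (E.cocomplex.X j) := fun j =>
    (Module.injective_iff_injective_object R _).2 (E.injective j)
  -- The kernels are the cosyzygies. An isomorphism of envelopes that matches the kernels induces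
  -- one of the quotients, and exactness identifies the quotient with the next kernel.
  have key : ∀ j, Nonempty
      (LinearMap.ker (E.cocomplex.d j (j + 1)).hom ≃ₗ[R] S.Z j) := by
    intro j
    induction j with
    | zero =>
      have hex := (ShortComplex.exact_of_f_is_kernel
        (ShortComplex.mk (E.ι.f 0) (E.cocomplex.d 0 1) E.ι_f_zero_comp_complex_d)
        E.isLimitKernelFork).moduleCat_range_eq_ker
      exact ⟨(LinearEquiv.ofEq _ _ hex.symm).trans <|
        (LinearEquiv.ofInjective (E.ι.f 0).hom
          ((ModuleCat.mono_iff_injective _).1 inferInstance)).symm.trans <|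
        (HomologicalComplex.singleObjXSelf (ComplexShape.up ℕ) 0 M).toLinearEquiv.trans e⟩
    | succ j ih =>
      obtain ⟨e⟩ := ih
      obtain ⟨φ, hφ⟩ := exists_equiv_of_essential (hE j) (hinj j) (S.injective j) e
        (S.i_injective j) (S.essential j)
      have hex := (E.exact_succ j).moduleCat_range_eq_ker
      have hker : LinearMap.ker (S.π j ∘ₗ φ.toLinearMap) =
          LinearMap.ker (E.cocomplex.d j (j + 1)).hom := by
        ext x
        rw [LinearMap.mem_ker, LinearMap.comp_apply, S.exact j]
        constructor
        · rintro ⟨z, hz⟩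
          obtain ⟨y, rfl⟩ := e.surjective z
          rw [← hφ] at hz
          rw [← φ.injective hz]
          exact y.2
        · intro hx
          exact ⟨e ⟨x, hx⟩, (hφ ⟨x, hx⟩).symm⟩
      exact ⟨(LinearEquiv.ofEq _ _ hex.symm).trans <|
        (LinearMap.quotKerEquivRange (E.cocomplex.d j (j + 1)).hom).symm.trans <|
        (Submodule.quotEquivOfEq _ _ hker.symm).trans <|
        LinearMap.quotKerEquivOfSurjective _ ((S.π_surjective j).comp φ.surjective)⟩
  obtain ⟨e'⟩ := key j
  obtain ⟨φ, _⟩ := exists_equiv_of_essential (hE j) (hinj j) (S.injective j) e'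
    (S.i_injective j) (S.essential j)
  exact ⟨φ⟩

/-- The complex formed by the injective envelopes. -/
noncomputable def cocomplex : CochainComplex (ModuleCat.{u} R) ℕ :=
  CochainComplex.of (fun j => ModuleCat.of R (S.X j))
    (fun j => ModuleCat.ofHom (S.i (j + 1) ∘ₗ S.π j)) fun j => by
      ext x
      simp [(S.exact (j + 1)).apply_apply_eq_zero]

theorem cocomplex_d (j : ℕ) :
    S.cocomplex.d j (j + 1) = ModuleCat.ofHom (S.i (j + 1) ∘ₗ S.π j) :=
  by simp [cocomplex]

theorem ker_cocomplex_d (j : ℕ) :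
    LinearMap.ker (S.cocomplex.d j (j + 1)).hom = LinearMap.range (S.i j) := by
  rw [cocomplex_d]
  ext x
  exact (map_eq_zero_iff _ (S.i_injective _)).trans (S.exact j x)

theorem range_cocomplex_d (j : ℕ) :
    LinearMap.range (S.cocomplex.d j (j + 1)).hom = LinearMap.range (S.i (j + 1)) := by
  rw [cocomplex_d]
  exact LinearMap.range_comp_of_range_eq_top _ (LinearMap.range_eq_top.2 (S.π_surjective j))

/-- The augmentation of the complex of injective envelopes. -/
noncomputable def augmentation (e : M ≃ₗ[R] S.Z 0) : M ⟶ S.cocomplex.X 0 :=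
  ModuleCat.ofHom (S.i 0 ∘ₗ e.toLinearMap)

theorem augmentation_d (e : M ≃ₗ[R] S.Z 0) : S.augmentation e ≫ S.cocomplex.d 0 1 = 0 := by
  rw [S.cocomplex_d 0]
  ext x
  change S.i 1 (S.π 0 (S.i 0 (e x))) = 0
  rw [(S.exact 0).apply_apply_eq_zero, map_zero]

theorem augmentation_mono (e : M ≃ₗ[R] S.Z 0) : Mono (S.augmentation e) :=
  (ModuleCat.mono_iff_injective _).2 ((S.i_injective 0).comp e.injective)

theorem augmentation_exact (e : M ≃ₗ[R] S.Z 0) :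
    (ShortComplex.mk _ _ (S.augmentation_d e)).Exact := by
  refine (ShortComplex.moduleCat_exact_iff_range_eq_ker _).2 ?_
  exact (LinearMap.range_comp_of_range_eq_top _ e.range).trans (S.ker_cocomplex_d 0).symm

theorem cocomplex_exactAt (n : ℕ) : S.cocomplex.ExactAt (n + 1) := by
  rw [HomologicalComplex.exactAt_iff' _ n (n + 1) (n + 1 + 1) (by simp) (by simp)]
  exact (ShortComplex.moduleCat_exact_iff_range_eq_ker _).2
    ((S.range_cocomplex_d n).trans (S.ker_cocomplex_d (n + 1)).symm)

/-- The injective resolution formed by the injective envelopes. -/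
noncomputable def resolution (e : M ≃ₗ[R] S.Z 0) : InjectiveResolution M where
  cocomplex := S.cocomplex
  injective j := Module.injective_object_of_injective_module R _ (inj := S.injective j)
  ι := (CochainComplex.fromSingle₀Equiv _ _).symm ⟨S.augmentation e, S.augmentation_d e⟩
  quasiIso := ⟨fun n => by
    cases n
    · rw [CochainComplex.quasiIsoAt₀_iff, ShortComplex.quasiIso_iff_of_zeros]
      · refine (ShortComplex.exact_and_mono_f_iff_of_iso ?_).2
          ⟨S.augmentation_exact e, S.augmentation_mono e⟩
        exact ShortComplex.isoMk (Iso.refl _) (Iso.refl _) (Iso.refl _)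
          ((Category.id_comp _).trans (Category.comp_id _).symm)
          ((Category.id_comp _).trans (Category.comp_id _).symm)
      all_goals rfl
    · rw [quasiIsoAt_iff_exactAt]
      · exact S.cocomplex_exactAt _
      · exact CochainComplex.exactAt_succ_single_obj _ _⟩

theorem isMinimal_resolution (e : M ≃ₗ[R] S.Z 0) :
    IsMinimalInjectiveResolution (S.resolution e) := fun j => by
  change IsEssentialSubmodule (LinearMap.ker (S.cocomplex.d j (j + 1)).hom)
  rw [ker_cocomplex_d]
  exact S.essential j

/-- The Gorenstein property in terms of the injective envelopes of the cosyzygies. -/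
theorem isNGorenstein_iff {A : Type u} [Ring A] (S : CosyzygyData Aᵐᵒᵖ) (e : A ≃ₗ[Aᵐᵒᵖ] S.Z 0)
    (n : ℕ) : IsNGorenstein n A ↔
      ∀ j < n, HasProjectiveDimensionLE (ModuleCat.of Aᵐᵒᵖ (S.X j)) j := by
  constructor
  · rintro ⟨E, hE, h⟩ j hj
    obtain ⟨φ⟩ := S.nonempty_equiv E hE e j
    have := h j hj
    exact hasProjectiveDimensionLT_of_iso (X := E.cocomplex.X j) φ.toModuleIso _
  · intro h
    exact ⟨S.resolution (M := ModuleCat.of Aᵐᵒᵖ A) e, S.isMinimal_resolution _, h⟩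

end CosyzygyData

end MinimalResolution

/-! ### The Gorenstein property of Nakayama algebras -/

namespace NakayamaDatum

variable {k : Type u} [Field k] {A : Type u} [Ring A] [Algebra k A] {N : ℕ} [NeZero N]

open Nakayama

/-- The `j`-th cosyzygy of the projective interval that belongs to `x`. -/
noncomputable def cosyzygyInterval (D : NakayamaDatum k A N) (j : ℕ) (x : ZMod N) : D.Interval where
  a := (cosyzygy D.q x.val (D.p x.val) j).1
  b := (cosyzygy D.q x.val (D.p x.val) j).2
  le := (cosyzygy_le D.gc (D.le_p _) le_rfl j).1
  le_p := (cosyzygy_le D.gc (D.le_p _) le_rfl j).2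

/-- The injective envelope of the `j`-th cosyzygy. -/
noncomputable def hullInterval (D : NakayamaDatum k A N) (j : ℕ) (x : ZMod N) : D.Interval where
  a := hullStart D.q (cosyzygy D.q x.val (D.p x.val) j)
  b := (cosyzygy D.q x.val (D.p x.val) j).2
  le := by
    have h := cosyzygy_le D.gc (D.le_p x.val) le_rfl j
    rw [hullStart]
    split_ifs
    · exact h.1
    · exact (D.gc.l_le h.2).trans h.1
  le_p := by
    have h := cosyzygy_le D.gc (D.le_p x.val) le_rfl j
    rw [hullStart]
    split_ifs
    · exact h.2
    · exact D.gc.le_u_l _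

variable (D : NakayamaDatum k A N)

theorem hullInterval_a_le (j : ℕ) (x : ZMod N) :
    (D.hullInterval j x).a ≤ (D.cosyzygyInterval j x).a := by
  have h := cosyzygy_le D.gc (D.le_p x.val) le_rfl j
  simp only [hullInterval, cosyzygyInterval, hullStart]
  split_ifs
  · exact le_rfl
  · exact D.gc.l_le h.2

theorem cosyzygyInterval_succ_a (j : ℕ) (x : ZMod N) :
    (D.cosyzygyInterval (j + 1) x).a = (D.hullInterval j x).a := by
  simp only [hullInterval, cosyzygyInterval, hullStart, cosyzygy]
  split_ifs <;> rfl

theorem cosyzygyInterval_succ_b (j : ℕ) (x : ZMod N) :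
    (D.cosyzygyInterval (j + 1) x).b = (D.cosyzygyInterval j x).a := by
  simp only [cosyzygyInterval, cosyzygy]
  split_ifs with h
  · exact h.symm
  · rfl

/-- The minimal injective resolution of the regular module in terms of interval modules. -/
noncomputable def cosyzygyData : CosyzygyData Aᵐᵒᵖ where
  Z j := ∀ x, (D.cosyzygyInterval j x).Mod
  X j := ∀ x, (D.hullInterval j x).Mod
  i j := piMap _ _ (D.hullInterval_a_le j) fun _ => le_rfl
  π j := piMap _ _ (fun x => (D.cosyzygyInterval_succ_a j x).le) fun x =>
    (D.cosyzygyInterval_succ_b j x).le.trans (D.cosyzygyInterval j x).le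
  i_injective j := piMap_injective fun _ => le_rfl
  π_surjective j := piMap_surjective fun x => (D.cosyzygyInterval_succ_a j x).ge
  exact j := piMap_exact (F := D.cosyzygyInterval j) (G := D.hullInterval j)
    (H := D.cosyzygyInterval (j + 1)) _ (fun _ => rfl) (D.cosyzygyInterval_succ_a j)
    (D.cosyzygyInterval_succ_b j) _
  injective j := pi_injective _ fun x => by
    simp only [hullInterval, hullStart]
    split_ifs with h
    · exact Or.inl h
    · exact Or.inr rfl
  essential j := piMap_range_essential (F := D.cosyzygyInterval j)
    (G := D.hullInterval j) _ (fun _ => rfl) fun x => by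
    rcases (D.cosyzygyInterval j x).le.lt_or_eq with h | h
    · exact Or.inl h
    · refine Or.inr ?_
      simp only [hullInterval, hullStart]
      exact (if_pos h).trans h

/-- The Gorenstein property of a Nakayama algebra in combinatorial terms. -/
theorem isNGorenstein_iff (D : NakayamaDatum k A N) (n : ℕ) :
    IsNGorenstein n A ↔ ∀ j < n, ∀ x : ZMod N, TermPdLE D.p D.q x.val j := by
  rw [D.cosyzygyData.isNGorenstein_iff D.regularEquiv]
  exact forall₂_congr fun j _ => hasProjectiveDimensionLE_pi_iff j (D.hullInterval j)

theorem isNGorenstein_succ (D : NakayamaDatum k A N) {n : ℕ} (h : IsNGorenstein (2 * n) A) :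
    IsNGorenstein (2 * n + 1) A := by
  rw [D.isNGorenstein_iff] at h ⊢
  intro j hj x
  rcases Nat.lt_succ_iff_lt_or_eq.1 hj with hj | rfl
  · exact h j hj x
  · exact TermPdLE.even D.gc (D.le_p _) fun m hm => h _ (by omega) x

end NakayamaDatum

/-! ### Nakayama algebras given by quivers -/

section QuiverAlgebra

variable {V : Type v} [Quiver.{w} V] {N : ℕ} {e : V ≃ ZMod N}

theorem path_end_eq (he : ∀ a b : V, (a ⟶ b) → e b = e a + 1) {a b : V} (p : Quiver.Path a b) :
    e b = e a + p.length := by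
  induction p with
  | nil => simp
  | cons p f ih =>
    rw [he _ _ f, ih, Quiver.Path.length_cons]
    push_cast
    ring

theorem path_eq_of_length_eq (he : ∀ a b : V, (a ⟶ b) → e b = e a + 1)
    (hs : ∀ a b : V, Subsingleton (a ⟶ b)) {a b : V} (p q : Quiver.Path a b)
    (h : p.length = q.length) : p = q := by
  induction p with
  | nil =>
    cases q with
    | nil => rfl
    | cons q g => simp at h
  | @cons b c p f ih =>
    cases q with
    | nil => simp at h
    | @cons b' c q g =>
      have hb : b = b' := by
        have h1 := (he _ _ f).symm.trans (he _ _ g)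
        exact e.injective (add_right_cancel h1)
      subst hb
      have := hs b c
      rw [ih q (by simpa using h), Subsingleton.elim f g]

/-- Every arrow raises the label by one and parallel arrows coincide, so start and length determine
a path. This makes the elements `w i l` of a datum well defined. -/
theorem quiverPath_ext (he : ∀ a b : V, (a ⟶ b) → e b = e a + 1)
    (hs : ∀ a b : V, Subsingleton (a ⟶ b)) {p q : QuiverPath V} (h : e p.1 = e q.1)
    (hl : p.2.2.length = q.2.2.length) : p = q := by
  obtain ⟨a, b, p⟩ := p
  obtain ⟨a', b', q⟩ := q
  simp only at h hl
  have ha := e.injective h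
  subst ha
  have hb : b = b' := e.injective (by rw [path_end_eq he p, path_end_eq he q, hl])
  subst hb
  rw [path_eq_of_length_eq he hs p q hl]

namespace PathAlgebra

variable {k : Type u} [Field k]

theorem ofPath_mem_arrowIdealPow [Fintype V] {m : ℕ} {p : QuiverPath V}
    (h : m ≤ p.2.2.length) : (ofPath p : PathAlgebra k V) ∈ arrowIdealPow k V m := by
  obtain ⟨a, b, p⟩ := p
  obtain ⟨c, p₁, p₂, rfl, hl⟩ := p.exists_eq_comp_of_le_length h
  rw [← pathMul_comp, ← mulHom_ofPath]
  exact TwoSidedIdeal.mul_mem_right _ _ _ (TwoSidedIdeal.subset_span ⟨_, hl, rfl⟩)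

theorem smul_mem [Fintype V] (I : TwoSidedIdeal (PathAlgebra k V)) (r : k) {x : PathAlgebra k V}
    (hx : x ∈ I) : r • x ∈ I := by
  rw [Algebra.smul_def]
  exact I.mul_mem_left _ _ hx

end PathAlgebra

open PathAlgebra in
/-- The path elements of a quotient of the path algebra. -/
theorem exists_nakayamaDatum [NeZero N] {k : Type u} [Field k] [Fintype V] {A : Type u} [Ring A] [Algebra k A]
    (he : ∀ a b : V, (a ⟶ b) → e b = e a + 1) (hs : ∀ a b : V, Subsingleton (a ⟶ b))
    (φ : PathAlgebra k V →ₐ[k] A) (hφ : Function.Surjective φ) {m : ℕ}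
    (hm : ∀ p : QuiverPath V, m ≤ p.2.2.length → φ (ofPath p) = 0) :
    ∃ D : NakayamaDatum k A N, ∀ p : QuiverPath V, D.w (e p.1) p.2.2.length = φ (ofPath p) := by
  classical
  -- The default `0` covers paths that would leave the end of a linear quiver, so that the line is
  -- treated like a cycle.
  let w : ZMod N → ℕ → A := fun i l =>
    if h : ∃ p : QuiverPath V, e p.1 = i ∧ p.2.2.length = l then φ (ofPath h.choose) else 0
  have hw : ∀ p : QuiverPath V, w (e p.1) p.2.2.length = φ (ofPath p) := by
    intro p
    have h : ∃ q : QuiverPath V, e q.1 = e p.1 ∧ q.2.2.length = p.2.2.length := ⟨p, rfl, rfl⟩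
    simp only [w]
    rw [dif_pos h, quiverPath_ext he hs h.choose_spec.1 h.choose_spec.2]
  have hw0 : ∀ i l, (¬∃ p : QuiverPath V, e p.1 = i ∧ p.2.2.length = l) → w i l = 0 :=
    fun i l h => dif_neg h
  have hmul : ∀ i l j m, w i l * w j m = if j = i + l then w i (l + m) else 0 := by
    intro i l j m
    by_cases h1 : ∃ p : QuiverPath V, e p.1 = i ∧ p.2.2.length = l
    · by_cases h2 : ∃ p : QuiverPath V, e p.1 = j ∧ p.2.2.length = m
      · obtain ⟨⟨a, b, p⟩, rfl, rfl⟩ := h1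
        obtain ⟨⟨c, d, q⟩, rfl, rfl⟩ := h2
        rw [hw, hw, ← map_mul]
        change φ (mulHom _ _) = _
        rw [mulHom_ofPath, ← path_end_eq he]
        split_ifs with h
        · have h' := e.injective h
          subst h'
          rw [pathMul_comp, ← hw, Quiver.Path.length_comp]
        · rw [pathMul_of_ne, map_zero]
          rintro rfl
          exact h rfl
      · rw [hw0 j m h2, mul_zero]
        split_ifs with h
        · rw [hw0]
          rintro ⟨⟨a, b, p⟩, ha, hl⟩
          simp only at ha hl
          obtain ⟨c, p₁, p₂, rfl, hl₁⟩ := p.exists_eq_comp_of_le_length (n := l) (by omega)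
          rw [Quiver.Path.length_comp] at hl
          refine h2 ⟨⟨c, b, p₂⟩, ?_, by simp only; omega⟩
          rw [h, path_end_eq he p₁, ha, hl₁]
        · rfl
    · rw [hw0 i l h1, zero_mul]
      split_ifs with h
      · rw [hw0]
        rintro ⟨⟨a, b, p⟩, ha, hl⟩
        simp only at ha hl
        obtain ⟨c, p₁, p₂, rfl, hl₁⟩ := p.exists_eq_comp_of_le_length (n := l) (by omega)
        exact h1 ⟨⟨a, c, p₁⟩, ha, hl₁⟩
      · rfl
  have hwm : ∀ i, ∃ l, w i l = 0 := by
    intro i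
    refine ⟨m, ?_⟩
    by_cases h : ∃ p : QuiverPath V, e p.1 = i ∧ p.2.2.length = m
    · obtain ⟨p, rfl, rfl⟩ := h
      rw [hw]
      exact hm p le_rfl
    · exact hw0 _ _ h
  -- The length `c i` is the first one at which the path from `i` vanishes; longer paths are
  -- multiples of it and vanish as well.
  refine ⟨⟨fun i => Nat.find (hwm i), w, hmul, ?_, ?_, ?_⟩, hw⟩
  · rw [← map_one φ]
    change _ = φ unit
    rw [unit, map_sum, ← e.sum_comp]
    exact Finset.sum_congr rfl fun a _ => hw ⟨a, a, Quiver.Path.nil⟩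
  · intro i l
    constructor
    · exact fun h => Nat.find_min' _ h
    · intro h
      have h1 := hmul i (Nat.find (hwm i)) (i + (Nat.find (hwm i) : ℕ)) (l - Nat.find (hwm i))
      rw [if_pos rfl, Nat.add_sub_cancel' h, Nat.find_spec (hwm i), zero_mul] at h1
      exact h1.symm
  · rw [eq_top_iff]
    rintro x -
    obtain ⟨x, rfl⟩ := hφ x
    induction x using PathAlgebra.induction_on with
    | path p =>
      rw [← hw]
      exact Submodule.subset_span ⟨(e p.1, p.2.2.length), rfl⟩
    | add x y hx hy =>
      rw [map_add]
      exact add_mem hx hy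
    | zero =>
      rw [map_zero]
      exact zero_mem _
    | smul r x hx =>
      rw [map_smul]
      exact Submodule.smul_mem _ _ hx

open PathAlgebra in
/-- The path elements of an admissible quotient of the path algebra. -/
theorem exists_nakayamaDatum_of_isQuiverAlgebra [NeZero N] {k : Type u} [Field k] [Fintype V] {A : Type u}
    [Ring A] [Algebra k A] (e : V ≃ ZMod N) (he : ∀ a b : V, (a ⟶ b) → e b = e a + 1)
    (hs : ∀ a b : V, Subsingleton (a ⟶ b)) (hA : IsQuiverAlgebra k V A) :
    Nonempty (NakayamaDatum k A N) := by
  obtain ⟨I, ⟨-, m, -, hm⟩, ⟨f⟩⟩ := hA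
  obtain ⟨D, -⟩ := exists_nakayamaDatum he hs
    ((f.symm : I.ringCon.Quotient →ₐ[k] A).comp (I.ringCon.mkₐ k))
    (f.symm.surjective.comp (RingCon.mkₐ_surjective (α := k) _)) (m := m) fun p hp => by
      have h : (ofPath p : PathAlgebra k V) ∈ I := hm (ofPath_mem_arrowIdealPow hp)
      have h' : I.ringCon.mkₐ k (ofPath p) = 0 := (RingCon.eq _).2 h
      rw [AlgHom.comp_apply, h', map_zero]
  exact ⟨D⟩

end QuiverAlgebra

/-- The vertices of the linear quiver as residue classes. -/
def linearVertexEquiv (N : ℕ) [NeZero N] : LinearQuiver N ≃ ZMod N where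
  toFun a := ((a.vertex : ℕ) : ZMod N)
  invFun x := ⟨⟨x.val, x.val_lt⟩⟩
  left_inv a := by
    simp only [ZMod.val_natCast_of_lt a.vertex.isLt]
  right_inv x := x.natCast_zmod_val

/-- The vertices of the cyclic quiver as residue classes. -/
def cyclicVertexEquiv (N : ℕ) [NeZero N] : CyclicQuiver N ≃ ZMod N where
  toFun a := ((a.vertex : ℕ) : ZMod N)
  invFun x := ⟨⟨x.val, x.val_lt⟩⟩
  left_inv a := by
    simp only [ZMod.val_natCast_of_lt a.vertex.isLt]
  right_inv x := x.natCast_zmod_val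

theorem linearVertexEquiv_arrow {N : ℕ} [NeZero N] (a b : LinearQuiver N) (f : a ⟶ b) :
    linearVertexEquiv N b = linearVertexEquiv N a + 1 := by
  change ((b.vertex : ℕ) : ZMod N) = ((a.vertex : ℕ) : ZMod N) + 1
  rw [f.down]
  push_cast
  rfl

theorem cyclicVertexEquiv_arrow {N : ℕ} [NeZero N] (a b : CyclicQuiver N) (f : a ⟶ b) :
    cyclicVertexEquiv N b = cyclicVertexEquiv N a + 1 := by
  change ((b.vertex : ℕ) : ZMod N) = ((a.vertex : ℕ) : ZMod N) + 1
  rw [f.down, ZMod.natCast_mod]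
  push_cast
  rfl

theorem linearQuiver_subsingleton {N : ℕ} (a b : LinearQuiver N) : Subsingleton (a ⟶ b) :=
  inferInstanceAs (Subsingleton (PLift _))

theorem cyclicQuiver_subsingleton {N : ℕ} (a b : CyclicQuiver N) : Subsingleton (a ⟶ b) :=
  inferInstanceAs (Subsingleton (PLift _))

theorem IsNakayamaAlgebra.isNGorenstein_succ {k : Type u} [Field k] {A : Type u} [Ring A]
    [Algebra k A] (hA : IsNakayamaAlgebra k A) {n : ℕ} (h : IsNGorenstein (2 * n) A) :
    IsNGorenstein (2 * n + 1) A := by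
  obtain ⟨N, hN, hA⟩ := hA
  have : NeZero N := ⟨by omega⟩
  rcases hA with hA | hA
  · obtain ⟨D⟩ := exists_nakayamaDatum_of_isQuiverAlgebra (linearVertexEquiv N)
      linearVertexEquiv_arrow linearQuiver_subsingleton hA
    exact D.isNGorenstein_succ h
  · obtain ⟨D⟩ := exists_nakayamaDatum_of_isQuiverAlgebra (cyclicVertexEquiv N)
      cyclicVertexEquiv_arrow cyclicQuiver_subsingleton hA
    exact D.isNGorenstein_succ h

/-! ### A Nakayama algebra for which the parity matters -/

section Example

open PathAlgebra

/-- The lengths of the projective modules: `4` for the vertex `0` and `3` for all other vertices. -/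
def exampleLength {N : ℕ} (i : ZMod N) : ℕ := if i = 0 then 4 else 3

theorem exampleLength_le {N : ℕ} (i : ZMod N) : 3 ≤ exampleLength i ∧ exampleLength i ≤ 4 := by
  unfold exampleLength
  split_ifs <;> decide

/-- The paths that vanish in the example. -/
def exampleZeroPaths (N : ℕ) [NeZero N] : Set (QuiverPath (CyclicQuiver N)) :=
  {p | exampleLength (cyclicVertexEquiv N p.1) ≤ p.2.2.length}

/-- The only delicate case is a nontrivial path followed by a vanishing one: the product has length
at least `1 + 3 = 4`, which suffices at every vertex. -/
theorem pathMul_mem_span_exampleZeroPaths (k : Type u) [Field k] {N : ℕ} [NeZero N]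
    {p q : QuiverPath (CyclicQuiver N)} (h : p ∈ exampleZeroPaths N ∨ q ∈ exampleZeroPaths N) :
    (pathMul p q : PathAlgebra k (CyclicQuiver N)) ∈
      Submodule.span k (pathBasis k (CyclicQuiver N) '' exampleZeroPaths N) := by
  obtain ⟨a, b, p⟩ := p
  obtain ⟨c, d, q⟩ := q
  by_cases hbc : b = c
  · subst hbc
    rw [pathMul_comp]
    refine Submodule.subset_span ⟨_, ?_, rfl⟩
    simp only [exampleZeroPaths, Set.mem_ofPred_eq, Quiver.Path.length_comp] at h ⊢
    rcases h with h | h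
    · omega
    · rcases p.length.eq_zero_or_pos with hp | hp
      · have := p.eq_of_length_zero hp
        subst this
        omega
      · have h1 := exampleLength_le (cyclicVertexEquiv N a)
        have h2 := exampleLength_le (cyclicVertexEquiv N b)
        omega
  · rw [pathMul_of_ne hbc]
    exact zero_mem _

/-- The ideal that is spanned by the vanishing paths. -/
noncomputable def exampleIdeal (k : Type u) [Field k] (N : ℕ) [NeZero N] :
    TwoSidedIdeal (PathAlgebra k (CyclicQuiver N)) :=
  TwoSidedIdeal.mk' (Submodule.span k (pathBasis k (CyclicQuiver N) '' exampleZeroPaths N))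
    (zero_mem _) add_mem neg_mem
    (by
      intro x y hy
      change mulHom x y ∈ _
      induction x using PathAlgebra.induction_on with
      | add a b ha hb => rw [map_add, LinearMap.add_apply]; exact add_mem ha hb
      | zero => rw [map_zero, LinearMap.zero_apply]; exact zero_mem _
      | smul r a ha => rw [map_smul, LinearMap.smul_apply]; exact Submodule.smul_mem _ _ ha
      | path p =>
        refine Submodule.span_induction (p := fun y _ => mulHom (ofPath p) y ∈ _) ?_ ?_ ?_ ?_ hy
        · rintro _ ⟨q, hq, rfl⟩
          exact (mulHom_ofPath (k := k) p q).symm ▸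
            pathMul_mem_span_exampleZeroPaths k (Or.inr hq)
        · rw [map_zero]; exact zero_mem _
        · intro x y _ _ hx hy
          rw [map_add]; exact add_mem hx hy
        · intro r x _ hx
          rw [map_smul]; exact Submodule.smul_mem _ _ hx)
    (by
      intro y x hy
      change mulHom y x ∈ _
      induction x using PathAlgebra.induction_on with
      | add a b ha hb => rw [map_add]; exact add_mem ha hb
      | zero => rw [map_zero]; exact zero_mem _
      | smul r a ha => rw [map_smul]; exact Submodule.smul_mem _ _ ha
      | path p =>
        refine Submodule.span_induction (p := fun y _ => mulHom y (ofPath p) ∈ _) ?_ ?_ ?_ ?_ hy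
        · rintro _ ⟨q, hq, rfl⟩
          exact (mulHom_ofPath (k := k) q p).symm ▸
            pathMul_mem_span_exampleZeroPaths k (Or.inl hq)
        · rw [map_zero, LinearMap.zero_apply]; exact zero_mem _
        · intro x y _ _ hx hy
          rw [map_add, LinearMap.add_apply]; exact add_mem hx hy
        · intro r x _ hx
          rw [map_smul, LinearMap.smul_apply]; exact Submodule.smul_mem _ _ hx)

variable (k : Type u) [Field k] (N : ℕ) [NeZero N]

theorem mem_exampleIdeal (x : PathAlgebra k (CyclicQuiver N)) : x ∈ exampleIdeal k N ↔
    x ∈ Submodule.span k (pathBasis k (CyclicQuiver N) '' exampleZeroPaths N) :=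
  TwoSidedIdeal.mem_mk' _ _ _ _ _ _ _

theorem ofPath_mem_exampleIdeal (p : QuiverPath (CyclicQuiver N)) :
    (ofPath p : PathAlgebra k (CyclicQuiver N)) ∈ exampleIdeal k N ↔
      exampleLength (cyclicVertexEquiv N p.1) ≤ p.2.2.length := by
  rw [mem_exampleIdeal]
  constructor
  · intro h
    by_contra h'
    exact (pathBasis k (CyclicQuiver N)).linearIndependent.notMem_span_image
      (s := exampleZeroPaths N) h' h
  · exact fun h => Submodule.subset_span ⟨p, h, rfl⟩

theorem exampleIdeal_isAdmissible : IsAdmissible (exampleIdeal k N) := by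
  refine ⟨fun x hx => ?_, 4, by norm_num, ?_⟩
  · have hx' := (mem_exampleIdeal k N x).1 hx
    refine Submodule.span_induction
      (p := fun x _ => x ∈ arrowIdealPow k (CyclicQuiver N) 2) ?_ (zero_mem _)
      (fun x y _ _ => add_mem) (fun r x _ => PathAlgebra.smul_mem _ r) hx'
    rintro _ ⟨p, hp, rfl⟩
    have h1 := exampleLength_le (cyclicVertexEquiv N p.1)
    have h2 : exampleLength (cyclicVertexEquiv N p.1) ≤ p.2.2.length := hp
    exact ofPath_mem_arrowIdealPow (by omega)
  · refine TwoSidedIdeal.span_le.2 ?_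
    rintro _ ⟨p, hp, rfl⟩
    refine (ofPath_mem_exampleIdeal k N p).2 ?_
    have h1 := exampleLength_le (cyclicVertexEquiv N p.1)
    omega

/-- The algebra of the example. -/
abbrev ExampleAlgebra : Type u := (exampleIdeal k N).ringCon.Quotient

theorem exampleAlgebra_isNakayama : IsNakayamaAlgebra k (ExampleAlgebra k N) :=
  ⟨N, Nat.one_le_iff_ne_zero.2 (NeZero.ne N),
    Or.inr ⟨exampleIdeal k N, exampleIdeal_isAdmissible k N, ⟨AlgEquiv.refl⟩⟩⟩

theorem exists_cyclic_path (a : CyclicQuiver N) (l : ℕ) :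
    ∃ (b : CyclicQuiver N) (p : Quiver.Path a b), p.length = l := by
  induction l with
  | zero => exact ⟨a, .nil, rfl⟩
  | succ l ih =>
    obtain ⟨b, p, hp⟩ := ih
    let c : CyclicQuiver N := ⟨⟨(b.vertex + 1) % N, Nat.mod_lt _ (NeZero.pos N)⟩⟩
    let f : b ⟶ c := ⟨rfl⟩
    exact ⟨c, p.cons f, by rw [Quiver.Path.length_cons, hp]⟩

/-- On a cycle every vertex starts a path of each length, so `w i l` is the class of an actual path
and the vanishing lengths can be read off the ideal. -/
theorem exists_exampleDatum :
    ∃ D : NakayamaDatum k (ExampleAlgebra k N) N, ∀ i, D.c i = exampleLength i := by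
  have hφ : ∀ p : QuiverPath (CyclicQuiver N),
      (exampleIdeal k N).ringCon.mkₐ k (ofPath p) = 0 ↔
        exampleLength (cyclicVertexEquiv N p.1) ≤ p.2.2.length := by
    intro p
    rw [← ofPath_mem_exampleIdeal k N p]
    exact RingCon.eq _
  obtain ⟨D, hD⟩ := exists_nakayamaDatum cyclicVertexEquiv_arrow cyclicQuiver_subsingleton
    ((exampleIdeal k N).ringCon.mkₐ k) (RingCon.mkₐ_surjective (α := k) _) (m := 4) fun p hp =>
      (hφ p).2 ((exampleLength_le _).2.trans hp)
  refine ⟨D, fun i => eq_of_forall_ge_iff fun l => ?_⟩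
  obtain ⟨a, rfl⟩ := (cyclicVertexEquiv N).surjective i
  obtain ⟨b, p, rfl⟩ := exists_cyclic_path N a l
  rw [← D.w_eq_zero]
  have h := hD ⟨a, b, p⟩
  simp only at h
  rw [h, hφ]

end Example

/-! ### The resolution of the projective at vertex `1` in the example -/

namespace Nakayama

section Example

variable {p q : ℤ → ℤ} {n : ℕ}

theorem not_dvd_of_lt {d t : ℤ} (h0 : t ≠ 0) (h1 : -d < t) (h2 : t < d) : ¬d ∣ t :=
  fun h => h0 (Int.eq_zero_of_abs_lt_dvd h (abs_lt.2 ⟨h1, h2⟩))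

theorem eq_of_galoisConnection (gc : GaloisConnection q p) {s t : ℤ} (h : t ≤ p s)
    (h' : p (s - 1) < t) : q t = s := by
  refine le_antisymm (gc.l_le h) ?_
  by_contra! h1
  have h2 := gc.le_u (show q t ≤ s - 1 by omega)
  omega

variable (gc : GaloisConnection q p) (hp₀ : ∀ j, (3 * n + 2 : ℤ) ∣ j → p j = j + 4)
  (hp₁ : ∀ j, ¬(3 * n + 2 : ℤ) ∣ j → p j = j + 3)

include gc hp₀ hp₁ in
theorem example_q {t : ℤ} (ht : ¬(3 * n + 2 : ℤ) ∣ t - 4) : q t = t - 3 := by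
  refine eq_of_galoisConnection gc ?_ ?_
  · by_cases h : (3 * n + 2 : ℤ) ∣ t - 3
    · rw [hp₀ _ h]; omega
    · rw [hp₁ _ h]; omega
  · rw [hp₁ _ (by rwa [show t - 3 - 1 = t - 4 by ring])]; omega

include gc hp₀ hp₁ in
theorem example_iterate_q_one {m : ℕ} (hm : m ≤ n + 1) : q^[m] 1 = 1 - 3 * m := by
  induction m with
  | zero => rfl
  | succ m ih =>
    rw [Function.iterate_succ_apply', ih (by omega), example_q gc hp₀ hp₁]
    · push_cast; ring
    · intro h
      -- For `m = n` the number `-3 * m - 3` lies just below `-(3 * n + 2)`; adding one period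
      -- brings it into the range of `not_dvd_of_lt`.
      refine not_dvd_of_lt (d := 3 * n + 2) (t := 1 - 3 * m - 4 + (3 * n + 2)) ?_ ?_ ?_
        (dvd_add h dvd_rfl) <;> omega

include gc hp₀ hp₁ in
theorem example_iterate_q_four (hn : 1 ≤ n) {m : ℕ} (hm : m ≤ n) : q^[m + 1] 4 = -3 * m := by
  induction m with
  | zero =>
    -- The exceptional length gives `p 0 = 4 = p 1`, so the envelope of `[1, 4)` is `[0, 4)`.
    refine eq_of_galoisConnection gc ?_ ?_
    · rw [hp₀ _ (by simp)]; omega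
    · rw [hp₁ _ (not_dvd_of_lt (by omega) (by omega) (by omega))]; omega
  | succ m ih =>
    rw [Function.iterate_succ_apply', ih (by omega), example_q gc hp₀ hp₁]
    · push_cast; ring
    · exact not_dvd_of_lt (by omega) (by omega) (by omega)

include hp₁ in
theorem example_p_one (hn : 1 ≤ n) : p 1 = 4 :=
  hp₁ 1 (not_dvd_of_lt (by omega) (by omega) (by omega))

include gc hp₀ hp₁ in
-- The cosyzygies of `[1, 4)` are `[1 - 3m, 3 - 3m)` in degree `2m > 0` and `[-3m, 1 - 3m)` in
-- degree `2m + 1`. Strong induction is needed because these formulas presuppose that no earlier one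
-- is empty.
theorem example_nondegenerate (hn : 1 ≤ n) {j : ℕ} (hj : j ≤ 2 * n + 1) :
    (cosyzygy q 1 (p 1) j).1 ≠ (cosyzygy q 1 (p 1) j).2 := by
  induction j using Nat.strong_induction_on with
  | _ j ih =>
    rw [example_p_one hp₁ hn] at ih ⊢
    rcases Nat.even_or_odd' j with ⟨m, rfl | rfl⟩
    · rw [cosyzygy_even fun i hi => ih i hi (by omega)]
      simp only
      rw [example_iterate_q_one gc hp₀ hp₁ (by omega)]
      rcases m with _ | m
      · simp
      · rw [example_iterate_q_four gc hp₀ hp₁ hn (by omega)]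
        omega
    · rw [cosyzygy_odd fun i hi => ih i hi (by omega)]
      simp only
      rw [example_iterate_q_one gc hp₀ hp₁ (by omega),
        example_iterate_q_four gc hp₀ hp₁ hn (by omega)]
      omega

include gc hp₀ hp₁ in
theorem example_odd_iff (hn : 1 ≤ n) {m : ℕ} (hm : m ≤ n) : TermPdLE p q 1 (2 * m + 1) ↔
    p^[m] (1 - 3 * m) = p^[m] (p (-3 * m - 2)) ∨
      p^[m] (p (-3 * m - 2)) = p^[m] (p (1 - 3 * m)) := by
  have hne := fun j hj => example_nondegenerate gc hp₀ hp₁ hn (j := j) hj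
  rw [TermPdLE, hullStart, if_neg (hne _ (by omega)), pdLE_odd,
    cosyzygy_odd fun i hi => hne i (by omega)]
  simp only
  rw [← Function.iterate_succ_apply' q, example_iterate_q_one gc hp₀ hp₁ (by omega),
    example_iterate_q_one gc hp₀ hp₁ (by omega), Function.iterate_succ_apply,
    Function.iterate_succ_apply, show (1 - 3 * ((m + 1 : ℕ) : ℤ)) = -3 * m - 2 by push_cast; ring]

include gc hp₀ hp₁ in
-- For `m < n` the start `-3m - 2` is not a multiple of `3n + 2`, so the term `[-3m-2, 1-3m)` is
-- itself projective.
theorem example_odd (hn : 1 ≤ n) {m : ℕ} (hm : m < n) : TermPdLE p q 1 (2 * m + 1) := by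
  rw [example_odd_iff gc hp₀ hp₁ hn hm.le]
  left
  rw [hp₁ (-3 * m - 2) (not_dvd_of_lt (by omega) (by omega) (by omega))]
  congr 1
  ring

include gc hp₀ hp₁ in
-- For `m = n` the start is `-(3n + 2)`, where `p` adds `4`. The three numbers to be compared become
-- `1`, `2` and `4`, so neither alternative holds.
theorem example_not (hn : 1 ≤ n) : ¬TermPdLE p q 1 (2 * n + 1) := by
  rw [example_odd_iff gc hp₀ hp₁ hn le_rfl, hp₀ (-3 * n - 2) ⟨-1, by ring⟩]
  have h1 : ∀ i ≤ n, p^[i] (1 - 3 * n) = 1 - 3 * n + 3 * i := by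
    intro i hi
    induction i with
    | zero => simp
    | succ i ih =>
      rw [Function.iterate_succ_apply', ih (by omega),
        hp₁ _ (not_dvd_of_lt (by omega) (by omega) (by omega))]
      push_cast; ring
  have h2 : ∀ i ≤ n, p^[i] (-3 * n - 2 + 4) = 2 - 3 * n + 3 * i := by
    intro i hi
    induction i with
    | zero => simp; ring
    | succ i ih =>
      rw [Function.iterate_succ_apply', ih (by omega),
        hp₁ _ (not_dvd_of_lt (by omega) (by omega) (by omega))]
      push_cast; ring
  rw [← Function.iterate_succ_apply p n (1 - 3 * n), Function.iterate_succ_apply', h1 n le_rfl,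
    h2 n le_rfl, show (1 - 3 * n + 3 * n : ℤ) = 1 by ring, example_p_one hp₁ hn]
  omega

include gc hp₀ hp₁ in
theorem example_terms (hn : 1 ≤ n) {x : ℤ} (hx : 0 ≤ x) (hx' : x < 3 * n + 2) {j : ℕ}
    (hj : j < 2 * n + 1) : TermPdLE p q x j := by
  have hle : ∀ x, x ≤ p x := by
    intro x
    by_cases h : (3 * n + 2 : ℤ) ∣ x
    · rw [hp₀ _ h]; omega
    · rw [hp₁ _ h]; omega
  by_cases h1 : x = 1
  · subst h1
    rcases Nat.even_or_odd' j with ⟨m, rfl | rfl⟩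
    · exact TermPdLE.even gc (hle _) fun i hi => example_odd gc hp₀ hp₁ hn (by omega)
    · exact example_odd gc hp₀ hp₁ hn (by omega)
  -- The remaining projectives are injective, so their cosyzygies vanish from degree `1` on. Degree
  -- `0` is the case of `TermPdLE.even` without hypotheses.
  rcases j with _ | j
  · exact TermPdLE.even (n := 0) gc (hle _) fun i hi => absurd hi (Nat.not_lt_zero i)
  have hq : q (p x) = x := by
    refine eq_of_galoisConnection gc le_rfl ?_
    rcases hx.eq_or_lt with rfl | hx
    · rw [hp₀ 0 (dvd_zero _), hp₁ _ (not_dvd_of_lt (by omega) (by omega) (by omega))]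
      omega
    · rw [hp₁ x (not_dvd_of_lt (by omega) (by omega) (by omega)),
        hp₁ (x - 1) (not_dvd_of_lt (by omega) (by omega) (by omega))]
      omega
  refine TermPdLE.of_degenerate (cosyzygy_degenerate (j := 1) ?_ (by omega))
  rw [cosyzygy]
  split_ifs with h
  · exact h
  · exact hq

end Example

end Nakayama

theorem exampleAlgebra_gorenstein (k : Type u) [Field k] {n : ℕ} (hn : 1 ≤ n) :
    IsNGorenstein (2 * n + 1) (ExampleAlgebra k (3 * n + 2)) ∧
      ¬IsNGorenstein (2 * n + 2) (ExampleAlgebra k (3 * n + 2)) := by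
  obtain ⟨D, hD⟩ := exists_exampleDatum k (3 * n + 2)
  have hdvd : ∀ j : ℤ, ((j : ZMod (3 * n + 2)) = 0) ↔ (3 * n + 2 : ℤ) ∣ j := by
    intro j
    rw [ZMod.intCast_zmod_eq_zero_iff_dvd]
    push_cast
    rfl
  have hp₀ : ∀ j, (3 * n + 2 : ℤ) ∣ j → D.p j = j + 4 := by
    intro j hj
    rw [NakayamaDatum.p, hD, exampleLength, if_pos ((hdvd j).2 hj)]
    rfl
  have hp₁ : ∀ j, ¬(3 * n + 2 : ℤ) ∣ j → D.p j = j + 3 := by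
    intro j hj
    rw [NakayamaDatum.p, hD, exampleLength, if_neg (mt (hdvd j).1 hj)]
    rfl
  rw [D.isNGorenstein_iff, D.isNGorenstein_iff]
  constructor
  · intro j hj x
    refine Nakayama.example_terms D.gc hp₀ hp₁ hn (by omega) ?_ hj
    have := x.val_lt
    omega
  · intro h
    have h1 := h (2 * n + 1) (by omega) 1
    have hv : (1 : ZMod (3 * n + 2)).val = 1 := by
      rw [ZMod.val_one_eq_one_mod, Nat.mod_eq_of_lt (by omega)]
    rw [hv] at h1
    exact Nakayama.example_not D.gc hp₀ hp₁ hn h1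

theorem mainTheorem7 (k : Type u) [Field k] :
    (∀ (A : Type u) [Ring A] [Algebra k A], IsNakayamaAlgebra k A →
      ∀ n : ℕ, 1 ≤ n → IsNGorenstein (2 * n) A → IsNGorenstein (2 * n + 1) A) ∧
    (∀ n : ℕ, 1 ≤ n → ∃ (A : Type u) (_ : Ring A) (_ : Algebra k A), IsNakayamaAlgebra k A ∧
      IsNGorenstein (2 * n + 1) A ∧ ¬ IsNGorenstein (2 * n + 2) A) :=
  ⟨fun _ _ _ hA _ _ h => hA.isNGorenstein_succ h, fun n hn =>
    ⟨ExampleAlgebra k (3 * n + 2), inferInstance, inferInstance, exampleAlgebra_isNakayama k _,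
      exampleAlgebra_gorenstein k hn⟩⟩
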